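/- All graphs are finite, simple and undirected. For a real number $a\ge 1$ and an integer $h\ge 1$ put $\alpha_h=\lceil a\,h\sqrt{\log h}\,\rceil$. Call $a\ge 1$ a Kostochka constant if for every $h\ge 1$ every graph that excludes the complete graph $K_{h+1}$ as a minor has average degree at most $a\,h\sqrt{\log h}$. Theorem. Kostochka constants exist. Let $a$ be any Kostochka constant, let $h\ge 1$, and let $G$ be a $K_{h+1}$-minor-free graph such that every prime factor of $|\operatorname{Aut}(G)|$ is greater than $\max\{\alpha_h,2\}$. Then $\operatorname{Aut}(G)$ is a repeated direct and wreath product of abelian groups; that is, $\operatorname{Aut}(G)$ belongs to the smallest isomorphism-closed class of groups that contains all abelian groups and is closed under direct products $\Gamma\times\Delta$ and regular wreath products $\Gamma\wr\Delta=\Gamma^{\Delta}\rtimes\Delta$ (where $\Delta$ permutes the coordinates by left multiplication). -/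

import Mathlib

universe u v

/-- `H` is a minor of `G`: there are pairwise disjoint branch sets in `G`, one for each vertex
of `H`, each inducing a (nonempty) connected subgraph of `G`, such that adjacent vertices of `H`
have branch sets joined by an edge of `G`. -/
def SimpleGraph.HasMinor {V : Type u} {W : Type v} (G : SimpleGraph V) (H : SimpleGraph W) : Prop :=
  ∃ B : W → Set V,
    (∀ w, (G.induce (B w)).Connected) ∧
    (∀ w w', w ≠ w' → Disjoint (B w) (B w')) ∧
    (∀ w w', H.Adj w w' → ∃ x ∈ B w, ∃ y ∈ B w', G.Adj x y)

/-- `G` excludes the complete graph on `k` vertices as a minor. -/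
def SimpleGraph.CompleteMinorFree {V : Type u} (G : SimpleGraph V) (k : ℕ) : Prop :=
  ¬ G.HasMinor (⊤ : SimpleGraph (Fin k))

/-- The average degree of a finite graph (and `0` for the graph without vertices). -/
noncomputable def SimpleGraph.averageDegree {V : Type u} [Fintype V] (G : SimpleGraph V)
    [DecidableRel G.Adj] : ℝ :=
  (∑ x : V, (G.degree x : ℝ)) / (Fintype.card V : ℝ)

/-- `a ≥ 1` is a constant such that, for every `h ≥ 1`, every finite graph without a `K_{h+1}`
minor has average degree at most `a * h * √(log h)`. -/
def IsKostochkaConstant (a : ℝ) : Prop :=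
  1 ≤ a ∧ ∀ h : ℕ, 1 ≤ h →
    ∀ (V : Type) [Fintype V] (G : SimpleGraph V) [DecidableRel G.Adj],
      G.CompleteMinorFree (h + 1) →
        G.averageDegree ≤ a * (h : ℝ) * Real.sqrt (Real.log (h : ℝ))

/-- The bound `⌈a * h * √(log h)⌉` on the average degree. -/
noncomputable def kostochkaBound (a : ℝ) (h : ℕ) : ℕ :=
  ⌈a * (h : ℝ) * Real.sqrt (Real.log (h : ℝ))⌉₊

/-- The smallest isomorphism-closed class of groups that contains all abelian groups and is closed
under direct products of two groups and under (regular) wreath products. -/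
inductive IsAbelianProductWreath : (Γ : Type u) → [Group Γ] → Prop
  | abelian (A : Type u) [Group A] (comm : ∀ x y : A, x * y = y * x) :
      IsAbelianProductWreath A
  | prod (Γ Δ : Type u) [Group Γ] [Group Δ] :
      IsAbelianProductWreath Γ → IsAbelianProductWreath Δ → IsAbelianProductWreath (Γ × Δ)
  | wreath (Γ Δ : Type u) [Group Γ] [Group Δ] :
      IsAbelianProductWreath Γ → IsAbelianProductWreath Δ →
        IsAbelianProductWreath (RegularWreathProduct Γ Δ)
  | of_mulEquiv (Γ Δ : Type u) [Group Γ] [Group Δ] (e : Γ ≃* Δ) :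
      IsAbelianProductWreath Γ → IsAbelianProductWreath Δ

/-!
There are two independent parts.

**Existence of Kostochka constants.** A graph with many edges has a minor with `n` vertices in which
every vertex is adjacent to at least `n / 2` others (`exists_minor_minDegree`), and that contains a
robust graph, one that stays connected when any eighth of its vertices is deleted
(`exists_isRobust_minor`). In a robust graph branch sets of a complete minor are chosen greedily. A
random sequence of about `√(log h)` vertices leaves so few vertices without a neighbour in it that
the next random sequence meets the neighbourhoods of all the earlier ones
(`exists_dominating_sequence`). Robustness makes each sequence connected at the cost of a constant
factor (`IsRobust.exists_connectedOn_range`), and the branch sets obtained have size of order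
`√(log h)`.

**Structure of the group.** A Kostochka constant enters only through the fact that every minor has a
vertex of degree at most `α`, while every nontrivial orbit of a subgroup has more than `α` elements.
Hence, if `Γ` acts on a minor, the stabilizers of adjacent vertices are comparable: otherwise the
orbit of the edge would be a graph of minimum degree greater than `α`
(`MinorDegreeLE.stabilizer_le_or_le`). So in a connected graph adjacent vertices can be merged
equivariantly, the one with the smaller stabilizer into the other, until a single orbit is left.
That orbit is a Cayley graph of `Γ ⧸ K`, where the normal subgroup `K` is the largest vertex
stabilizer (`MinorDegreeLE.exists_cayley_contraction`), and `Γ ⧸ K` is abelian since a noncommuting pair of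
generators would give a biclique minor (`MinorDegreeLE.commute_of_adj_one`).

Let `R` be the set of vertices with stabilizer `K`. As `Γ` has odd order, no automorphism fixing `R`
pointwise can move a component of `V \ R`: the exchange of the component with its image would be an
involution (`not_disjoint_image_of_odd`). Another biclique minor shows that the stabilizer of such a
component is exactly `K` (`MinorDegreeLE.eq_top_of_invariant_connectedOn`). Thus `Γ ⧸ K` permutes
the components freely. Collecting one component from each orbit into a set `W`, one obtains `V \ R`
as a disjoint union of translates of `W` indexed by `Γ ⧸ K`, and `Γ` is the regular wreath product
of the group induced on `W` with `Γ ⧸ K` (`nonempty_colorAut_mulEquiv_wreath`). The group induced on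
`W` is the group of automorphisms that preserve the neighbourhoods in `R`; hence the induction
runs over graphs with a vertex colouring. A disconnected graph yields a direct product, since by the
same involution its components are preserved.
-/

/-! ### Connected sets of vertices and minors -/

namespace SimpleGraph

variable {V : Type u} {G : SimpleGraph V}

/-- `x` and `y` are joined by a walk of `G` that stays in `s` (or they are equal). -/
def JoinedIn (G : SimpleGraph V) (s : Set V) : V → V → Prop :=
  Relation.ReflTransGen fun a b => a ∈ s ∧ b ∈ s ∧ G.Adj a b

/-- `s` is nonempty and induces a connected subgraph of `G`, expressed without passing to the
subtype; see `induce_connected_iff_connectedOn`. -/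
def ConnectedOn (G : SimpleGraph V) (s : Set V) : Prop :=
  s.Nonempty ∧ ∀ x ∈ s, ∀ y ∈ s, G.JoinedIn s x y

/-- Some edge of `G` runs from `s` to `t`. -/
def Linked (G : SimpleGraph V) (s t : Set V) : Prop :=
  ∃ x ∈ s, ∃ y ∈ t, G.Adj x y

theorem JoinedIn.refl {s : Set V} (x : V) : G.JoinedIn s x x := Relation.ReflTransGen.refl

theorem JoinedIn.trans {s : Set V} {x y z : V} (h : G.JoinedIn s x y) (h' : G.JoinedIn s y z) :
    G.JoinedIn s x z := Relation.ReflTransGen.trans h h'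

theorem JoinedIn.mono {s t : Set V} (hst : s ⊆ t) {x y : V} (h : G.JoinedIn s x y) :
    G.JoinedIn t x y :=
  Relation.ReflTransGen.mono (fun _ _ h => ⟨hst h.1, hst h.2.1, h.2.2⟩) _ _ h

theorem JoinedIn.of_adj {s : Set V} {x y : V} (hx : x ∈ s) (hy : y ∈ s) (h : G.Adj x y) :
    G.JoinedIn s x y := Relation.ReflTransGen.single ⟨hx, hy, h⟩

theorem JoinedIn.symm {s : Set V} {x y : V} (h : G.JoinedIn s x y) : G.JoinedIn s y x := by
  induction h with
  | refl => exact .refl _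
  | tail _ h ih => exact .trans (.of_adj h.2.1 h.1 h.2.2.symm) ih

theorem JoinedIn.mem {s : Set V} {x y : V} (h : G.JoinedIn s x y) (hx : x ∈ s) : y ∈ s := by
  induction h with
  | refl => exact hx
  | tail _ h _ => exact h.2.1

theorem Linked.symm {s t : Set V} (h : G.Linked s t) : G.Linked t s := by
  obtain ⟨x, hx, y, hy, h⟩ := h
  exact ⟨y, hy, x, hx, h.symm⟩

theorem Linked.mono {s t s' t' : Set V} (hs : s ⊆ s') (ht : t ⊆ t') (h : G.Linked s t) :
    G.Linked s' t' := by
  obtain ⟨x, hx, y, hy, h⟩ := h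
  exact ⟨x, hs hx, y, ht hy, h⟩

theorem connectedOn_singleton (x : V) : G.ConnectedOn {x} :=
  ⟨⟨x, rfl⟩, by rintro _ rfl _ rfl; exact .refl _⟩

theorem ConnectedOn.of_root {s : Set V} {x : V} (hx : x ∈ s) (h : ∀ y ∈ s, G.JoinedIn s x y) :
    G.ConnectedOn s :=
  ⟨⟨x, hx⟩, fun y hy z hz => (h y hy).symm.trans (h z hz)⟩

theorem induce_connected_iff_connectedOn {s : Set V} :
    (G.induce s).Connected ↔ G.ConnectedOn s := by
  constructor
  · intro h
    refine ⟨let ⟨x⟩ := h.nonempty; ⟨x, x.2⟩, fun x hx y hy => ?_⟩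
    have := (SimpleGraph.reachable_iff_reflTransGen _ _).1 (h.preconnected ⟨x, hx⟩ ⟨y, hy⟩)
    exact Relation.ReflTransGen.lift Subtype.val (fun a b hab => ⟨a.2, b.2, hab⟩) _ _ this
  · rintro ⟨⟨x, hx⟩, h⟩
    have key : ∀ y, G.JoinedIn s x y → ∃ hy : y ∈ s, (G.induce s).Reachable ⟨x, hx⟩ ⟨y, hy⟩ := by
      intro y hy
      induction hy with
      | refl => exact ⟨hx, .refl _⟩
      | tail _ hbc ih =>
        obtain ⟨hb, ih⟩ := ih
        exact ⟨hbc.2.1, ih.trans (SimpleGraph.Adj.reachable (by exact hbc.2.2))⟩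
    refine (SimpleGraph.connected_iff_exists_forall_reachable _).2 ⟨⟨x, hx⟩, fun y => ?_⟩
    exact (key y (h x hx y y.2)).2

theorem connectedOn_univ_iff : G.ConnectedOn Set.univ ↔ G.Connected := by
  rw [← induce_connected_iff_connectedOn]
  exact (SimpleGraph.induceUnivIso G).connected_iff

/-- A family of connected sets whose "linked" relation is connected has a connected union. -/
theorem connectedOn_biUnion {ι : Type*} {B : ι → Set V} {T : Set ι} (hT : T.Nonempty)
    (hB : ∀ i ∈ T, G.ConnectedOn (B i))
    (h : ∀ i ∈ T, ∀ j ∈ T,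
      Relation.ReflTransGen (fun i j => i ∈ T ∧ j ∈ T ∧ G.Linked (B i) (B j)) i j) :
    G.ConnectedOn (⋃ i ∈ T, B i) := by
  obtain ⟨i, hi⟩ := hT
  obtain ⟨x, hx⟩ := (hB i hi).1
  have hsub : ∀ j ∈ T, B j ⊆ ⋃ i ∈ T, B i := fun j hj => Set.subset_biUnion_of_mem hj
  refine .of_root (hsub i hi hx) fun y hy => ?_
  obtain ⟨j, hj, hy⟩ := Set.mem_iUnion₂.1 hy
  have := h i hi j hj
  clear hj
  induction this generalizing y with
  | refl => exact ((hB i hi).2 x hx y hy).mono (hsub i hi)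
  | tail _ hbc ih =>
    obtain ⟨hb, hc, p, hp, q, hq, hpq⟩ := hbc
    refine (ih p (hsub _ hb hp) hp).trans (.trans (.of_adj (hsub _ hb hp) (hsub _ hc hq) hpq) ?_)
    exact ((hB _ hc).2 q hq y hy).mono (hsub _ hc)

theorem ConnectedOn.biUnion {ι : Type*} {H : SimpleGraph ι} {B : ι → Set V} {T : Set ι}
    (hT : H.ConnectedOn T) (hB : ∀ i ∈ T, G.ConnectedOn (B i))
    (hH : ∀ i ∈ T, ∀ j ∈ T, H.Adj i j → G.Linked (B i) (B j)) :
    G.ConnectedOn (⋃ i ∈ T, B i) :=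
  connectedOn_biUnion hT.1 hB fun i hi j hj =>
    Relation.ReflTransGen.mono (fun a b h => ⟨h.1, h.2.1, hH a h.1 b h.2.1 h.2.2⟩) _ _
      (hT.2 i hi j hj)

theorem ConnectedOn.image_val {s : Set V} {t : Set s} (h : (G.induce s).ConnectedOn t) :
    G.ConnectedOn (Subtype.val '' t) := by
  refine ⟨h.1.image _, ?_⟩
  rintro _ ⟨x, hx, rfl⟩ _ ⟨y, hy, rfl⟩
  exact Relation.ReflTransGen.lift Subtype.val
    (fun a b hab => ⟨⟨a, hab.1, rfl⟩, ⟨b, hab.2.1, rfl⟩, hab.2.2⟩) _ _ (h.2 x hx y hy)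

theorem hasMinor_iff {W : Type v} {H : SimpleGraph W} : G.HasMinor H ↔ ∃ B : W → Set V,
    (∀ w, G.ConnectedOn (B w)) ∧ (∀ w w', w ≠ w' → Disjoint (B w) (B w')) ∧
    (∀ w w', H.Adj w w' → G.Linked (B w) (B w')) := by
  simp only [HasMinor, induce_connected_iff_connectedOn, Linked]

theorem HasMinor.trans {W : Type*} {X : Type*} {H : SimpleGraph W} {K : SimpleGraph X}
    (h : G.HasMinor H) (h' : H.HasMinor K) : G.HasMinor K := by
  obtain ⟨B, hB, hd, ha⟩ := hasMinor_iff.1 h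
  obtain ⟨C, hC, hd', ha'⟩ := hasMinor_iff.1 h'
  refine hasMinor_iff.2 ⟨fun x => ⋃ w ∈ C x, B w, fun x => ?_, fun x y hxy => ?_, fun x y hxy => ?_⟩
  · exact (hC x).biUnion (fun w _ => hB w) fun w _ w' _ => ha w w'
  · simp only [Set.disjoint_iUnion_left, Set.disjoint_iUnion_right]
    intro w hw w' hw'
    exact hd _ _ fun h => Set.disjoint_left.1 (hd' x y hxy) hw' (h ▸ hw)
  · obtain ⟨w, hw, w', hw', hww⟩ := ha' x y hxy
    exact (ha w w' hww).mono (Set.subset_biUnion_of_mem hw) (Set.subset_biUnion_of_mem hw')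

theorem hasMinor_of_injective {W : Type*} {H : SimpleGraph W} (f : W → V)
    (hf : Function.Injective f) (h : ∀ x y, H.Adj x y → G.Adj (f x) (f y)) : G.HasMinor H :=
  hasMinor_iff.2 ⟨fun w => {f w}, fun _ => connectedOn_singleton _,
    fun _ _ hw => Set.disjoint_singleton.2 fun h => hw (hf h),
    fun w w' hw => ⟨f w, rfl, f w', rfl, h w w' hw⟩⟩

theorem hasMinor_induce (s : Set V) : G.HasMinor (G.induce s) :=
  hasMinor_of_injective Subtype.val Subtype.val_injective fun _ _ h => h

/-- Every nonempty finite minor of `G` has a vertex of degree at most `α`. This is all that the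
group theoretic part of the argument uses about the excluded minor. Minors on `Fin n` suffice and
keep the definition independent of universes. -/
def MinorDegreeLE (G : SimpleGraph V) (α : ℕ) : Prop :=
  ∀ n : ℕ, 0 < n → ∀ H : SimpleGraph (Fin n), G.HasMinor H → ∃ w, (H.neighborSet w).ncard ≤ α

theorem MinorDegreeLE.of_hasMinor {α : ℕ} {W : Type*} {H : SimpleGraph W}
    (h : G.MinorDegreeLE α) (hm : G.HasMinor H) : H.MinorDegreeLE α :=
  fun n hn K hK => h n hn K (hm.trans hK)

/-- In a finite family of disjoint connected sets some member is linked to few others. -/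
theorem MinorDegreeLE.exists_few_linked {α : ℕ} (h : G.MinorDegreeLE α) {W : Type*} [Finite W]
    [Nonempty W] (B : W → Set V) (hB : ∀ w, G.ConnectedOn (B w))
    (hd : ∀ w w', w ≠ w' → Disjoint (B w) (B w')) :
    ∃ w, {w' | w' ≠ w ∧ G.Linked (B w) (B w')}.ncard ≤ α := by
  let e := (Finite.equivFin W).symm
  obtain ⟨i, hi⟩ := h (Nat.card W) Nat.card_pos
    { Adj := fun i j => i ≠ j ∧ G.Linked (B (e i)) (B (e j))
      symm := ⟨fun i j h => ⟨h.1.symm, h.2.symm⟩⟩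
      loopless := ⟨fun i h => h.1 rfl⟩ }
    (hasMinor_iff.2 ⟨fun i => B (e i), fun i => hB _,
      fun i j hij => hd _ _ fun h => hij (e.injective h),
      fun i j hij => hij.2⟩)
  refine ⟨e i, le_trans (le_of_eq ?_) hi⟩
  rw [← Set.ncard_image_of_injective _ e.injective]
  congr 1
  ext w
  simp only [Set.mem_ofPred_eq, Set.mem_image, mem_neighborSet]
  constructor
  · rintro ⟨hw, hl⟩
    refine ⟨e.symm w, ⟨fun h => hw ?_, by simpa using hl⟩, by simp⟩
    simp [h]
  · rintro ⟨j, hj, rfl⟩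
    exact ⟨fun h => hj.1 (e.injective h).symm, hj.2⟩

/-- No `K_{m,n}` minor with `m, n > α`. -/
theorem MinorDegreeLE.no_biclique {α : ℕ} (h : G.MinorDegreeLE α) {X Y : Type*} [Finite X]
    [Finite Y] (hX : α < Nat.card X) (hY : α < Nat.card Y) (B : X → Set V) (C : Y → Set V)
    (hB : ∀ x, G.ConnectedOn (B x)) (hC : ∀ y, G.ConnectedOn (C y))
    (hBd : ∀ x x', x ≠ x' → Disjoint (B x) (B x'))
    (hCd : ∀ y y', y ≠ y' → Disjoint (C y) (C y')) (hBC : ∀ x y, Disjoint (B x) (C y))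
    (hl : ∀ x y, G.Linked (B x) (C y)) : False := by
  have : Nonempty X := (Nat.card_pos_iff.1 (by omega)).1
  obtain ⟨w, hw⟩ := h.exists_few_linked (W := X ⊕ Y) (Sum.elim B C)
    (by rintro (x | y) <;> simp [hB, hC])
    (by
      rintro (x | y) (x' | y') hne
      · exact hBd _ _ fun h => hne (h ▸ rfl)
      · exact hBC _ _
      · exact (hBC _ _).symm
      · exact hCd _ _ fun h => hne (h ▸ rfl))
  rcases w with x | y
  · have : Set.range (Sum.inr : Y → X ⊕ Y) ⊆
        {w' | w' ≠ Sum.inl x ∧ G.Linked (Sum.elim B C (Sum.inl x)) (Sum.elim B C w')} := by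
      rintro _ ⟨y, rfl⟩
      exact ⟨by simp, hl x y⟩
    have := Set.ncard_le_ncard this (Set.toFinite _)
    rw [← Set.image_univ, Set.ncard_image_of_injective _ Sum.inr_injective, Set.ncard_univ] at this
    omega
  · have : Set.range (Sum.inl : X → X ⊕ Y) ⊆
        {w' | w' ≠ Sum.inr y ∧ G.Linked (Sum.elim B C (Sum.inr y)) (Sum.elim B C w')} := by
      rintro _ ⟨x, rfl⟩
      exact ⟨by simp, (hl x y).symm⟩
    have := Set.ncard_le_ncard this (Set.toFinite _)
    rw [← Set.image_univ, Set.ncard_image_of_injective _ Sum.inl_injective, Set.ncard_univ] at this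
    omega

end SimpleGraph

/-! ### Finite groups all of whose prime divisors are large -/

/-- Every prime divisor of the order of `Γ` is greater than `α`. -/
def PrimeDivisorsGT (Γ : Type*) (α : ℕ) : Prop :=
  ∀ p : ℕ, p.Prime → p ∣ Nat.card Γ → α < p

theorem PrimeDivisorsGT.of_dvd {Γ Δ : Type*} {α : ℕ} (h : PrimeDivisorsGT Γ α)
    (hd : Nat.card Δ ∣ Nat.card Γ) : PrimeDivisorsGT Δ α :=
  fun p hp hpd => h p hp (hpd.trans hd)

theorem PrimeDivisorsGT.lt_of_dvd {Γ : Type*} [Nonempty Γ] [Finite Γ] {α m : ℕ}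
    (h : PrimeDivisorsGT Γ α) (hd : m ∣ Nat.card Γ) (hm : m ≠ 1) : α < m := by
  have hpos : 0 < m := Nat.pos_of_dvd_of_pos hd Nat.card_pos
  exact (h _ (Nat.minFac_prime hm) ((Nat.minFac_dvd m).trans hd)).trans_le (Nat.minFac_le hpos)

theorem PrimeDivisorsGT.lt_card_orbit {Γ Ω : Type*} [Group Γ] [Finite Γ] [MulAction Γ Ω] {α : ℕ}
    (h : PrimeDivisorsGT Γ α) {H : Subgroup Γ} {ω : Ω} (hH : ¬ H ≤ MulAction.stabilizer Γ ω) :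
    α < (MulAction.orbit H ω).ncard := by
  rw [← MulAction.index_stabilizer]
  refine h.lt_of_dvd ((Subgroup.index_dvd_card _).trans (Subgroup.card_subgroup_dvd_card H)) ?_
  rw [Ne, Subgroup.index_eq_one]
  intro htop
  refine hH fun g hg => ?_
  have : (⟨g, hg⟩ : H) ∈ MulAction.stabilizer H ω := htop ▸ Subgroup.mem_top _
  exact this

/-! ### Group actions on graphs without dense minors -/

namespace SimpleGraph

variable {V : Type*} {G : SimpleGraph V}

/-- The group `Γ` acts on `G` by automorphisms. -/
def IsInvariant (G : SimpleGraph V) (Γ : Type*) [SMul Γ V] : Prop :=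
  ∀ (g : Γ) (x y : V), G.Adj (g • x) (g • y) ↔ G.Adj x y

theorem ConnectedOn.exists_adj_boundary (h : G.ConnectedOn Set.univ) {P : V → Prop} {x y : V}
    (hx : P x) (hy : ¬ P y) : ∃ a b, G.Adj a b ∧ P a ∧ ¬ P b := by
  have := h.2 x trivial y trivial
  by_contra! hcon
  refine hy ?_
  clear hy
  induction this with
  | refl => exact hx
  | tail _ h ih => exact hcon _ _ h.2.2 ih

/-- If `P` holds somewhere and propagates along edges of a connected graph it holds everywhere. -/
theorem ConnectedOn.forall_of_adj (h : G.ConnectedOn Set.univ) {P : V → Prop} {x : V}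
    (hx : P x) (hP : ∀ a b, G.Adj a b → P a → P b) (y : V) : P y := by
  by_contra hy
  obtain ⟨a, b, hab, ha, hb⟩ := h.exists_adj_boundary hx hy
  exact hb (hP a b hab ha)

section Action

variable {Γ : Type*} [Group Γ] [MulAction Γ V] {Ω : Type*} [MulAction Γ Ω]

theorem Linked.smul_fibre (hG : G.IsInvariant Γ) {F : V → Ω}
    (hF : ∀ (g : Γ) x, F (g • x) = g • F x) {a b : Ω} (h : G.Linked (F ⁻¹' {a}) (F ⁻¹' {b}))
    (g : Γ) : G.Linked (F ⁻¹' {g • a}) (F ⁻¹' {g • b}) := by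
  obtain ⟨x, hx, y, hy, h⟩ := h
  simp only [Set.mem_preimage, Set.mem_singleton_iff] at hx hy
  exact ⟨g • x, by simp [hF, hx], g • y, by simp [hF, hy], (hG g x y).2 h⟩

variable [Finite Γ]

/-- The stabilizers of adjacent vertices are comparable, also after the connected fibres of an
equivariant map have been contracted. Otherwise each of the two stabilizers moves the other vertex
through an orbit of size greater than `α`, so that the orbit of the edge is a graph of minimum
degree greater than `α`. -/
theorem MinorDegreeLE.stabilizer_le_or_le {α : ℕ} (hα : G.MinorDegreeLE α) (hG : G.IsInvariant Γ)
    (hΓ : PrimeDivisorsGT Γ α) {F : V → Ω} (hF : ∀ (g : Γ) x, F (g • x) = g • F x)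
    (hc : ∀ x, G.ConnectedOn (F ⁻¹' {F x})) {x y : V} (hxy : G.Adj x y) (hne : F x ≠ F y) :
    MulAction.stabilizer Γ (F x) ≤ MulAction.stabilizer Γ (F y) ∨
      MulAction.stabilizer Γ (F y) ≤ MulAction.stabilizer Γ (F x) := by
  by_contra! hcon
  let S : Set Ω := MulAction.orbit Γ (F x) ∪ MulAction.orbit Γ (F y)
  have hS : ∀ (g : Γ) {ω}, ω ∈ S → g • ω ∈ S := by
    rintro g ω (h | h)
    · exact Or.inl (MulAction.mem_orbit_of_mem_orbit g h)
    · exact Or.inr (MulAction.mem_orbit_of_mem_orbit g h)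
  have : Finite S := ((Set.finite_range _).union (Set.finite_range _)).to_subtype
  have hxS : F x ∈ S := Or.inl (MulAction.mem_orbit_self _)
  have hyS : F y ∈ S := Or.inr (MulAction.mem_orbit_self _)
  have : Nonempty S := ⟨F x, hxS⟩
  have aux : ∀ x y, G.Adj x y → F x ≠ F y → F y ∈ S →
      ¬ MulAction.stabilizer Γ (F x) ≤ MulAction.stabilizer Γ (F y) → ∀ w : S, ∀ g : Γ,
      g • F x = w →
      α < {w' : S | w' ≠ w ∧ G.Linked (F ⁻¹' {(w : Ω)}) (F ⁻¹' {(w' : Ω)})}.ncard := by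
    intro x y hxy hne hyS hle w g hg
    refine (hΓ.lt_card_orbit hle).trans_le ?_
    rw [← Set.ncard_image_of_injective _ (MulAction.injective g),
      ← Set.ncard_image_of_injective {w' : S | _} Subtype.val_injective]
    refine Set.ncard_le_ncard ?_ (Set.toFinite _)
    rintro _ ⟨_, ⟨k, rfl⟩, rfl⟩
    have hk : (k : Γ) • F x = F x := k.2
    refine ⟨⟨g • (k : Γ) • F y, hS _ (hS _ hyS)⟩, ⟨fun h => hne ?_, ?_⟩, rfl⟩
    · have h2 : g • (k : Γ) • F y = g • F x := (congrArg Subtype.val h).trans hg.symm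
      have h3 := MulAction.injective g h2
      exact MulAction.injective (k : Γ) (hk.trans h3.symm)
    · have hl : G.Linked (F ⁻¹' {F x}) (F ⁻¹' {F y}) := ⟨x, rfl, y, rfl, hxy⟩
      have := (hl.smul_fibre hG hF (k : Γ)).smul_fibre hG hF g
      rw [hk, hg] at this
      exact this
  obtain ⟨w, hw⟩ := hα.exists_few_linked (W := S) (fun w => F ⁻¹' {(w : Ω)})
    (by
      rintro ⟨w, ⟨g, rfl⟩ | ⟨g, rfl⟩⟩
      · simpa [hF] using hc (g • x)
      · simpa [hF] using hc (g • y))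
    (fun w w' h => by
      rw [Set.disjoint_left]
      rintro v hv hv'
      exact h (Subtype.ext (hv.symm.trans hv')))
  rcases w.2 with ⟨g, hg⟩ | ⟨g, hg⟩
  · exact absurd hw (not_le.2 (aux x y hxy hne hyS hcon.1 w g hg))
  · exact absurd hw (not_le.2 (aux y x hxy.symm hne.symm hxS hcon.2 w g hg))

/-- If the contracted graph is connected and vertex-transitive, all its vertices have the same
stabilizer. -/
theorem MinorDegreeLE.stabilizer_eq {α : ℕ} (hα : G.MinorDegreeLE α) (hG : G.IsInvariant Γ)
    (hconn : G.ConnectedOn Set.univ)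
    (hΓ : PrimeDivisorsGT Γ α) {F : V → Ω} (hF : ∀ (g : Γ) x, F (g • x) = g • F x)
    (hc : ∀ x, G.ConnectedOn (F ⁻¹' {F x})) (ht : ∀ x y, F x ∈ MulAction.orbit Γ (F y)) (x y : V) :
    MulAction.stabilizer Γ (F x) = MulAction.stabilizer Γ (F y) := by
  have hcard : ∀ a b, Nat.card (MulAction.stabilizer Γ (F a)) =
      Nat.card (MulAction.stabilizer Γ (F b)) := by
    intro a b
    have ha := (MulAction.stabilizer Γ (F a)).card_mul_index
    have hb := (MulAction.stabilizer Γ (F b)).card_mul_index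
    rw [MulAction.index_stabilizer, MulAction.orbit_eq_iff.2 (ht a b), ← hb,
      MulAction.index_stabilizer] at ha
    refine Nat.eq_of_mul_eq_mul_right ?_ ha
    exact (Set.ncard_pos (Set.finite_range _)).2 ⟨_, MulAction.mem_orbit_self _⟩
  refine (hconn.forall_of_adj (P := fun y => MulAction.stabilizer Γ (F x) =
    MulAction.stabilizer Γ (F y)) rfl (fun a b hab h => h.trans ?_) y)
  by_cases hne : F a = F b
  · rw [hne]
  rcases hα.stabilizer_le_or_le hG hΓ hF hc hab hne with h | h
  · exact Subgroup.eq_of_le_of_card_ge h (hcard _ _).le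
  · exact (Subgroup.eq_of_le_of_card_ge h (hcard _ _).le).symm

theorem MinorDegreeLE.stabilizer_normal {α : ℕ} (hα : G.MinorDegreeLE α) (hG : G.IsInvariant Γ)
    (hconn : G.ConnectedOn Set.univ)
    (hΓ : PrimeDivisorsGT Γ α) {F : V → Ω} (hF : ∀ (g : Γ) x, F (g • x) = g • F x)
    (hc : ∀ x, G.ConnectedOn (F ⁻¹' {F x})) (ht : ∀ x y, F x ∈ MulAction.orbit Γ (F y)) (x : V) :
    (MulAction.stabilizer Γ (F x)).Normal := by
  refine ⟨fun n hn g => ?_⟩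
  rw [hα.stabilizer_eq hG hconn hΓ hF hc ht x (g • x), hF]
  have : n • F x = F x := hn
  simp [MulAction.mem_stabilizer_iff, mul_smul, this]

/-- A connected graph can be contracted equivariantly onto a single orbit: as long as the image of
`F` has several orbits there are adjacent fibres in distinct orbits, and the one with the smaller
stabilizer can be absorbed by the other. -/
theorem MinorDegreeLE.exists_equivariant_contraction {α : ℕ} [Finite V] (hα : G.MinorDegreeLE α)
    (hG : G.IsInvariant Γ) (hconn : G.ConnectedOn Set.univ) (hΓ : PrimeDivisorsGT Γ α) :
    ∃ F : V → V, (∀ (g : Γ) x, F (g • x) = g • F x) ∧ (∀ x, F (F x) = F x) ∧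
      (∀ x, G.ConnectedOn (F ⁻¹' {F x})) ∧ ∀ x y, F x ∈ MulAction.orbit Γ (F y) := by
  classical
  let P : (V → V) → Prop := fun F => (∀ (g : Γ) x, F (g • x) = g • F x) ∧ (∀ x, F (F x) = F x) ∧
      (∀ x, G.ConnectedOn (F ⁻¹' {F x}))
  obtain ⟨F, hPF, hmin⟩ := (measure fun F : V → V => (Set.range F).ncard).wf.has_min {F | P F}
    ⟨id, fun _ _ => rfl, fun _ => rfl, fun x => connectedOn_singleton x⟩
  obtain ⟨hF, hFF, hc⟩ : P F := hPF
  refine ⟨F, hF, hFF, hc, ?_⟩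
  by_contra! hcon
  obtain ⟨x₀, y₀, hxy₀⟩ := hcon
  obtain ⟨a, b, hab, ha, hb⟩ := hconn.exists_adj_boundary
    (P := fun z => F z ∈ MulAction.orbit Γ (F y₀)) (MulAction.mem_orbit_self _) hxy₀
  have hnorb : F a ∉ MulAction.orbit Γ (F b) := fun h =>
    hb ((MulAction.orbit_eq_iff.2 h).symm.trans (MulAction.orbit_eq_iff.2 ha) ▸
      MulAction.mem_orbit_self _)
  have hne : F a ≠ F b := fun h => hnorb (h ▸ MulAction.mem_orbit_self _)
  clear ha hb hxy₀ x₀ y₀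
  wlog hle : MulAction.stabilizer Γ (F a) ≤ MulAction.stabilizer Γ (F b) generalizing a b
  · refine this b a hab.symm (fun h => hnorb ((MulAction.mem_orbit_symm).1 h)) hne.symm ?_
    exact (hα.stabilizer_le_or_le hG hΓ hF hc hab hne).resolve_left hle
  let m : V → V := fun v => if h : v ∈ MulAction.orbit Γ (F a) then h.choose • F b else v
  have hm₁ : ∀ g : Γ, m (g • F a) = g • F b := by
    intro g
    have h : g • F a ∈ MulAction.orbit Γ (F a) := ⟨g, rfl⟩
    simp only [m, dif_pos h]
    have hs : h.choose • F a = g • F a := h.choose_spec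
    have : g⁻¹ * h.choose ∈ MulAction.stabilizer Γ (F b) :=
      hle (by rw [MulAction.mem_stabilizer_iff, mul_smul, hs, inv_smul_smul])
    rw [MulAction.mem_stabilizer_iff, mul_smul, inv_smul_eq_iff] at this
    exact this
  have hm₂ : ∀ v, v ∉ MulAction.orbit Γ (F a) → m v = v := fun v hv => dif_neg hv
  have hso : ∀ (g : Γ) v, g • v ∈ MulAction.orbit Γ (F a) ↔ v ∈ MulAction.orbit Γ (F a) :=
    fun g v => ⟨fun h => by simpa using MulAction.mem_orbit_of_mem_orbit g⁻¹ h,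
      MulAction.mem_orbit_of_mem_orbit g⟩
  have hm₃ : ∀ v, m v ∉ MulAction.orbit Γ (F a) := by
    intro v hv
    by_cases h : v ∈ MulAction.orbit Γ (F a)
    · obtain ⟨g, rfl⟩ := h
      simp only [hm₁] at hv
      exact hnorb (MulAction.mem_orbit_symm.1 ((hso g _).1 hv))
    · rw [hm₂ v h] at hv
      exact h hv
  have hmF : ∀ v, F (m (F v)) = m (F v) := by
    intro v
    by_cases h : F v ∈ MulAction.orbit Γ (F a)
    · obtain ⟨g, hg⟩ := h
      simp only at hg
      rw [← hg, hm₁, hF, hFF]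
    · rw [hm₂ _ h, hFF]
  have hme : ∀ (g : Γ) v, m (g • v) = g • m v := by
    intro g v
    by_cases h : v ∈ MulAction.orbit Γ (F a)
    · obtain ⟨k, rfl⟩ := h
      simp only [hm₁, smul_smul]
    · rw [hm₂ _ h, hm₂ _ (by rwa [hso])]
  refine hmin (m ∘ F) ⟨fun g v => by simp [hF, hme], fun v => ?_, fun v => ?_⟩ ?_
  · simp only [Function.comp, hmF]
    exact hm₂ _ (hm₃ _)
  · -- the fibre of `z` is the old fibre of `z` with the absorbed fibres attached to it
    let z := m (F v)
    have hz : F z = z := hmF v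
    have hzo : z ∉ MulAction.orbit Γ (F a) := hm₃ _
    let T : Set V := {t | F t = t ∧ m t = z}
    have hzT : z ∈ T := ⟨hz, hm₂ _ hzo⟩
    have hlink : ∀ t ∈ T, t = z ∨ G.Linked (F ⁻¹' {t}) (F ⁻¹' {z}) := by
      rintro t ⟨ht, htz⟩
      by_cases h : t ∈ MulAction.orbit Γ (F a)
      · obtain ⟨g, rfl⟩ := h
        right
        simp only [hm₁] at htz
        rw [← htz]
        have hl : G.Linked (F ⁻¹' {F a}) (F ⁻¹' {F b}) := ⟨a, rfl, b, rfl, hab⟩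
        exact hl.smul_fibre hG hF g
      · left
        rw [← htz, hm₂ _ h]
    have : (m ∘ F) ⁻¹' {(m ∘ F) v} = ⋃ t ∈ T, F ⁻¹' {t} := by
      ext p
      simp only [Set.mem_preimage, Function.comp, Set.mem_singleton_iff, Set.mem_iUnion,
        exists_prop]
      constructor
      · intro hp
        exact ⟨F p, ⟨hFF p, hp⟩, rfl⟩
      · rintro ⟨t, ht, rfl⟩
        exact ht.2
    rw [this]
    have hto : ∀ t ∈ T, Relation.ReflTransGen
        (fun i j => i ∈ T ∧ j ∈ T ∧ G.Linked (F ⁻¹' {i}) (F ⁻¹' {j})) t z := by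
      intro t ht
      rcases hlink t ht with rfl | h
      · exact .refl
      · exact .single ⟨ht, hzT, h⟩
    have hfrom : ∀ t ∈ T, Relation.ReflTransGen
        (fun i j => i ∈ T ∧ j ∈ T ∧ G.Linked (F ⁻¹' {i}) (F ⁻¹' {j})) z t := by
      intro t ht
      rcases hlink t ht with rfl | h
      · exact .refl
      · exact .single ⟨hzT, ht, h.symm⟩
    refine connectedOn_biUnion ⟨z, hzT⟩ (fun t ht => ?_)
      fun s hs t ht => (hto s hs).trans (hfrom t ht)
    have := hc t
    rwa [ht.1] at this
  · refine Set.ncard_lt_ncard ⟨?_, fun h => ?_⟩ (Set.toFinite _)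
    · rintro _ ⟨v, rfl⟩
      exact ⟨m (F v), hmF v⟩
    · obtain ⟨v, hv⟩ := h ⟨a, rfl⟩
      exact hm₃ (F v) (by rw [show m (F v) = F a from hv]; exact MulAction.mem_orbit_self _)

end Action

end SimpleGraph

/-! ### Contractions onto Cayley graphs -/

namespace SimpleGraph

section Contract

variable {V : Type*} {G : SimpleGraph V} {A : Type*} {π : V → A}

/-- The graph obtained from `G` by identifying vertices with equal image under `π` and discarding
loops and multiple edges. It is a minor of `G` if the fibres of `π` are connected. -/
def contract (G : SimpleGraph V) (π : V → A) : SimpleGraph A where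
  Adj a b := a ≠ b ∧ G.Linked (π ⁻¹' {a}) (π ⁻¹' {b})
  symm := ⟨fun _ _ h => ⟨h.1.symm, h.2.symm⟩⟩
  loopless := ⟨fun _ h => h.1 rfl⟩

theorem hasMinor_contract (hc : ∀ a, G.ConnectedOn (π ⁻¹' {a})) : G.HasMinor (G.contract π) :=
  hasMinor_iff.2 ⟨fun a => π ⁻¹' {a}, hc,
    fun _ _ h => Set.disjoint_left.2 fun _ ha hb => h (ha.symm.trans hb), fun _ _ h => h.2⟩

theorem ConnectedOn.contract (hG : G.ConnectedOn Set.univ) (hπ : Function.Surjective π) :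
    (G.contract π).ConnectedOn Set.univ := by
  obtain ⟨x, -⟩ := hG.1
  refine .of_root (x := π x) trivial fun a _ => ?_
  obtain ⟨y, rfl⟩ := hπ a
  refine hG.forall_of_adj (P := fun y => (G.contract π).JoinedIn Set.univ (π x) (π y)) (.refl _)
    (fun a b hab h => ?_) y
  by_cases hne : π a = π b
  · rwa [← hne]
  · exact h.trans (.of_adj trivial trivial ⟨hne, a, rfl, b, rfl, hab⟩)

theorem ConnectedOn.preimage_of_contract {T : Set A} (hT : (G.contract π).ConnectedOn T)
    (hc : ∀ a, G.ConnectedOn (π ⁻¹' {a})) : G.ConnectedOn (π ⁻¹' T) := by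
  rw [← Set.biUnion_preimage_singleton]
  exact hT.biUnion (fun a _ => hc a) fun _ _ _ _ h => h.2

end Contract

section Cayley

variable {A : Type*} [Group A] {Q : SimpleGraph A}

theorem connectedOn_segment (hQ : Q.IsInvariant A) {x : A} (hx : Q.Adj 1 x) (a : A) {n : ℕ}
    (hn : 0 < n) : Q.ConnectedOn {b | ∃ j < n, b = a * x ^ j} := by
  refine .of_root (x := a) ⟨0, hn, by simp⟩ ?_
  rintro _ ⟨j, hj, rfl⟩
  induction j with
  | zero => simpa using .refl _
  | succ j ih =>
    refine (ih (by omega)).trans (.of_adj ⟨j, by omega, rfl⟩ ⟨j + 1, hj, rfl⟩ ?_)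
    have := (hQ (a * x ^ j) 1 x).2 hx
    simpa [smul_eq_mul, mul_assoc, pow_succ] using this

theorem segment_inj {L : Subgroup A} {x : A} {d : ℕ} (hd : ∀ j, 0 < j → j < d → x ^ j ∉ L)
    {a b : A} (ha : a ∈ L) (hb : b ∈ L) {i j : ℕ} (hi : i < d) (hj : j < d)
    (h : a * x ^ i = b * x ^ j) : a = b := by
  wlog hij : i ≤ j generalizing a b i j
  · exact (this hb ha hj hi h.symm (by omega)).symm
  obtain ⟨k, rfl⟩ := Nat.exists_eq_add_of_le hij
  have hk : x ^ k = b⁻¹ * a := by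
    rw [add_comm, pow_add, ← mul_assoc] at h
    rw [mul_right_cancel h]
    group
  have : k = 0 := by
    by_contra hk0
    exact hd k (by omega) (by omega) (hk ▸ L.mul_mem (L.inv_mem hb) ha)
  subst this
  simpa using h

theorem MinorDegreeLE.zpowers_normal [Finite A] {α : ℕ} (hα : Q.MinorDegreeLE α)
    (hQ : Q.IsInvariant A) (hconn : Q.ConnectedOn Set.univ) (hA : PrimeDivisorsGT A α) {x : A}
    (hx : Q.Adj 1 x) : (Subgroup.zpowers x).Normal := by
  classical
  have := hα.stabilizer_normal (Γ := A) (Ω := A ⧸ Subgroup.zpowers x) (F := fun a => (a : A ⧸ _))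
    hQ hconn hA (fun _ _ => rfl) (fun a => ?_) (fun a b => ?_) 1
  · rwa [MulAction.stabilizer_quotient] at this
  · convert connectedOn_segment hQ hx a (orderOf_pos x) using 1
    ext b
    simp only [Set.mem_preimage, Set.mem_singleton_iff, Set.mem_ofPred_eq]
    rw [eq_comm, QuotientGroup.eq, mem_zpowers_iff_mem_range_orderOf]
    simp only [Finset.mem_image, Finset.mem_range]
    refine exists_congr fun j => and_congr_right fun _ => ?_
    rw [eq_inv_mul_iff_mul_eq, eq_comm]
  · exact MulAction.IsPretransitive.exists_smul_eq _ _

/-- Two neighbours `x`, `y` of the identity commute. Otherwise `⟨x⟩` and `⟨y⟩` are normal and the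
commutator `c` lies in both, hence is central in `⟨x, y⟩`. Cutting the cosets `⟨x⟩` and `y⟨x⟩` into
segments of length `[⟨x⟩ : ⟨c⟩]`, indexed by `⟨c⟩`, gives a biclique minor: right multiplication
by `y` shears the first coset against the second by powers of `c`, and a segment is long enough to
meet all powers. -/
theorem MinorDegreeLE.commute_of_adj_one [Finite A] {α : ℕ} (hα : Q.MinorDegreeLE α)
    (hQ : Q.IsInvariant A) (hconn : Q.ConnectedOn Set.univ) (hA : PrimeDivisorsGT A α) {x y : A}
    (hx : Q.Adj 1 x) (hy : Q.Adj 1 y) : Commute x y := by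
  classical
  by_contra hxy
  have hnx := hα.zpowers_normal hQ hconn hA hx
  have hny := hα.zpowers_normal hQ hconn hA hy
  obtain ⟨c, hc⟩ : ∃ c, c = x⁻¹ * y⁻¹ * x * y := ⟨_, rfl⟩
  have hcx : c ∈ Subgroup.zpowers x := by
    have := hnx.conj_mem x (Subgroup.mem_zpowers x) y⁻¹
    have h2 := Subgroup.mul_mem _ (Subgroup.inv_mem _ (Subgroup.mem_zpowers x)) this
    rw [hc]
    simpa [mul_assoc] using h2
  have hcy : c ∈ Subgroup.zpowers y := by
    have := hny.conj_mem _ (Subgroup.inv_mem _ (Subgroup.mem_zpowers y)) x⁻¹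
    have h2 := Subgroup.mul_mem _ this (Subgroup.mem_zpowers y)
    rw [hc]
    simpa [mul_assoc] using h2
  have hcommx : Commute c x := by
    obtain ⟨n, rfl⟩ := Subgroup.mem_zpowers_iff.1 hcx
    exact (Commute.refl x).zpow_left n
  have hcommy : Commute c y := by
    obtain ⟨n, hn⟩ := Subgroup.mem_zpowers_iff.1 hcy
    rw [← hn]
    exact (Commute.refl y).zpow_left n
  have hxyc : x * y = y * (x * c) := by rw [hc]; group
  have hpow : ∀ j : ℕ, x ^ j * y = y * x ^ j * c ^ j := by
    intro j
    have h1 : x ^ j * y = y * (x * c) ^ j := by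
      induction j with
      | zero => simp
      | succ j ih => rw [pow_succ, mul_assoc, hxyc, ← mul_assoc, ih, mul_assoc, ← pow_succ]
    rw [h1, hcommx.symm.mul_pow, mul_assoc]
  have hc1 : c ≠ 1 := by
    rintro rfl
    exact hxy (show x * y = y * x by simpa using hxyc)
  have hr : α < Nat.card (Subgroup.zpowers c) := by
    refine hA.lt_of_dvd (Subgroup.card_subgroup_dvd_card _) ?_
    rw [Nat.card_zpowers]
    exact fun h => hc1 (orderOf_eq_one_iff.1 h)
  have hex : ∃ d, 0 < d ∧ x ^ d ∈ Subgroup.zpowers c :=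
    ⟨orderOf x, orderOf_pos x, by rw [pow_orderOf_eq_one]; exact Subgroup.one_mem _⟩
  obtain ⟨d, ⟨hd0, hdc⟩, hdmin⟩ : ∃ d, (0 < d ∧ x ^ d ∈ Subgroup.zpowers c) ∧
      ∀ j, 0 < j → j < d → x ^ j ∉ Subgroup.zpowers c :=
    ⟨Nat.find hex, Nat.find_spec hex, fun j hj hjd h => Nat.find_min hex hjd ⟨hj, h⟩⟩
  have hzy : ∀ a ∈ Subgroup.zpowers c, Commute a y := by
    intro a ha
    obtain ⟨n, rfl⟩ := Subgroup.mem_zpowers_iff.1 ha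
    exact hcommy.zpow_left n
  have hzx : ∀ a ∈ Subgroup.zpowers c, Commute a x := by
    intro a ha
    obtain ⟨n, rfl⟩ := Subgroup.mem_zpowers_iff.1 ha
    exact hcommx.zpow_left n
  have hrd : orderOf c ≤ d := by
    refine Nat.le_of_dvd hd0 (orderOf_dvd_of_pow_eq_one ?_)
    have h1 := hpow d
    rw [(hzy _ hdc).eq] at h1
    exact (mul_eq_left.1 h1.symm)
  have hyx : y ∉ Subgroup.zpowers x := by
    intro h
    obtain ⟨n, rfl⟩ := Subgroup.mem_zpowers_iff.1 h
    exact hxy ((Commute.refl x).zpow_right n)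
  have hzsub : ∀ a ∈ Subgroup.zpowers c, a ∈ Subgroup.zpowers x := fun a ha =>
    (Subgroup.zpowers_le.2 hcx) ha
  refine hα.no_biclique hr hr
    (fun a : Subgroup.zpowers c => {b | ∃ j < d, b = (a : A) * x ^ j})
    (fun a : Subgroup.zpowers c => {b | ∃ j < d, b = y * (a : A) * x ^ j})
    (fun a => connectedOn_segment hQ hx _ hd0) (fun a => connectedOn_segment hQ hx _ hd0)
    ?_ ?_ ?_ ?_
  · intro a a' hne
    rw [Set.disjoint_left]
    rintro _ ⟨i, hi, rfl⟩ ⟨j, hj, h⟩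
    exact hne (Subtype.ext (segment_inj hdmin a.2 a'.2 hi hj h))
  · intro a a' hne
    rw [Set.disjoint_left]
    rintro _ ⟨i, hi, rfl⟩ ⟨j, hj, h⟩
    rw [mul_assoc, mul_assoc] at h
    exact hne (Subtype.ext (segment_inj hdmin a.2 a'.2 hi hj (mul_left_cancel h)))
  · intro a a'
    rw [Set.disjoint_left]
    rintro _ ⟨i, hi, rfl⟩ ⟨j, hj, h⟩
    refine hyx ?_
    have : y = (a : A) * x ^ i * ((a' : A) * x ^ j)⁻¹ := by rw [h]; group
    rw [this]
    have hp : ∀ k : ℕ, x ^ k ∈ Subgroup.zpowers x := fun k =>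
      Subgroup.pow_mem _ (Subgroup.mem_zpowers x) k
    exact Subgroup.mul_mem _ (Subgroup.mul_mem _ (hzsub _ a.2) (hp i))
      (Subgroup.inv_mem _ (Subgroup.mul_mem _ (hzsub _ a'.2) (hp j)))
  · intro a b
    have hmem : (a : A)⁻¹ * b ∈ Subgroup.zpowers c :=
      Subgroup.mul_mem _ (Subgroup.inv_mem _ a.2) b.2
    rw [mem_zpowers_iff_mem_range_orderOf, Finset.mem_image] at hmem
    obtain ⟨j, hj, hjc⟩ := hmem
    rw [Finset.mem_range] at hj
    refine ⟨a * x ^ j, ⟨j, by omega, rfl⟩, y * b * x ^ j, ⟨j, by omega, rfl⟩, ?_⟩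
    have hadj := (hQ (a * x ^ j) 1 y).2 hy
    have hb : (b : A) = a * c ^ j := by rw [hjc]; group
    have heq : (a : A) * x ^ j * y = y * b * x ^ j := by
      rw [mul_assoc, hpow, ← mul_assoc, ← mul_assoc, (hzy _ a.2).eq, hb, mul_assoc,
        ((hcommx.pow_left j).pow_right j).eq.symm]
      simp only [mul_assoc]
    rw [← heq]
    simpa using hadj

/-- A finite group with large prime divisors that acts regularly on a connected graph without dense
minors is abelian. -/
theorem MinorDegreeLE.mul_comm [Finite A] {α : ℕ} (hα : Q.MinorDegreeLE α)
    (hQ : Q.IsInvariant A) (hconn : Q.ConnectedOn Set.univ) (hA : PrimeDivisorsGT A α) (x y : A) :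
    x * y = y * x := by
  have hgen : ∀ a, a ∈ Subgroup.closure {s | Q.Adj 1 s} := by
    refine hconn.forall_of_adj (Subgroup.one_mem _) fun a b hab ha => ?_
    have : a⁻¹ * b ∈ Subgroup.closure {s | Q.Adj 1 s} := by
      refine Subgroup.subset_closure ?_
      have := (hQ a⁻¹ a b).2 hab
      simpa using this
    simpa using Subgroup.mul_mem _ ha this
  have := Subgroup.closure_induction₂ (p := fun x y _ _ => Commute x y)
    (fun x y hx hy => hα.commute_of_adj_one hQ hconn hA hx hy) (fun _ _ => .one_left _)
    (fun _ _ => .one_right _) (fun _ _ _ _ _ _ h h' => h.mul_left h')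
    (fun _ _ _ _ _ _ h h' => h.mul_right h') (fun _ _ _ _ h => h.inv_left)
    (fun _ _ _ _ h => h.inv_right) (hgen x) (hgen y)
  exact this

end Cayley

section Action

variable {V : Type*} {G : SimpleGraph V} {Γ : Type*} [Group Γ] [MulAction Γ V]

theorem contract_isInvariant (hG : G.IsInvariant Γ) {K : Subgroup Γ} [K.Normal] {π : V → Γ ⧸ K}
    (hπ : ∀ (g : Γ) v, π (g • v) = g * π v) : (G.contract π).IsInvariant (Γ ⧸ K) := by
  have key : ∀ (c a b : Γ ⧸ K), (G.contract π).Adj a b → (G.contract π).Adj (c * a) (c * b) := by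
    rintro c a b ⟨hne, x, hx, y, hy, hxy⟩
    obtain ⟨g, rfl⟩ := QuotientGroup.mk_surjective c
    simp only [Set.mem_preimage, Set.mem_singleton_iff] at hx hy
    exact ⟨fun h => hne (mul_left_cancel h), g • x, by simp [hπ, hx], g • y, by simp [hπ, hy],
      (hG _ _ _).2 hxy⟩
  intro c a b
  simp only [smul_eq_mul]
  exact ⟨fun h => by simpa using key c⁻¹ _ _ h, key c a b⟩

variable [Finite Γ]

/-- A connected graph without dense minors can be contracted equivariantly onto a Cayley graph of
the quotient of the acting group by a vertex stabilizer. -/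
theorem MinorDegreeLE.exists_cayley_contraction {α : ℕ} [Finite V] (hα : G.MinorDegreeLE α)
    (hG : G.IsInvariant Γ) (hconn : G.ConnectedOn Set.univ) (hΓ : PrimeDivisorsGT Γ α) :
    ∃ (K : Subgroup Γ) (_ : K.Normal) (π : V → Γ ⧸ K), (∃ v : V, K = MulAction.stabilizer Γ v) ∧
      (∀ (g : Γ) v, π (g • v) = g * π v) ∧ Function.Surjective π ∧
      ∀ a, G.ConnectedOn (π ⁻¹' {a}) := by
  obtain ⟨F, hF, hFF, hc, ht⟩ := hα.exists_equivariant_contraction hG hconn hΓ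
  obtain ⟨v₀, -⟩ := hconn.1
  let K := MulAction.stabilizer Γ (F v₀)
  have hK : K.Normal := hα.stabilizer_normal hG hconn hΓ hF hc ht v₀
  choose q hq using fun v => ht v v₀
  have hπ : ∀ v (g : Γ), ((q v : Γ) : Γ ⧸ K) = g ↔ F v = g • F v₀ := by
    intro v g
    rw [QuotientGroup.eq, ← hq v]
    simp only [K, MulAction.mem_stabilizer_iff, mul_smul, inv_smul_eq_iff]
    exact eq_comm
  refine ⟨K, hK, fun v => (q v : Γ ⧸ K), ⟨F v₀, rfl⟩, fun g v => ?_, fun a => ?_, fun a => ?_⟩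
  · exact (hπ (g • v) (g * q v)).2 (by rw [hF, mul_smul]; exact congrArg _ (hq v).symm)
  · obtain ⟨g, rfl⟩ := QuotientGroup.mk_surjective a
    exact ⟨g • v₀, (hπ _ _).2 (hF _ _)⟩
  · obtain ⟨g, rfl⟩ := QuotientGroup.mk_surjective a
    convert hc (g • v₀) using 1
    ext v
    simp only [Set.mem_preimage, Set.mem_singleton_iff]
    rw [hπ, hF]

/-- Let `C` be a connected set, invariant under the group, whose vertices all have stabilizers
properly contained in the normal subgroup `K`, and suppose that `C` has a neighbour `r` with
stabilizer `K`. Then `K` is the whole group. Otherwise contract `C` onto a Cayley graph of `Γ ⧸ K'`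
with `K' < K` and let `s` be one of its generators outside `K`. With `d` the order of `s` modulo
`K`, the segments of length `d` in direction `s`, indexed by `K ⧸ K'`, and the vertices `s ^ j • r`
form a biclique minor. -/
theorem MinorDegreeLE.eq_top_of_invariant_connectedOn {α : ℕ} [Finite V] (hα : G.MinorDegreeLE α)
    (hG : G.IsInvariant Γ) (hΓ : PrimeDivisorsGT Γ α) {K : Subgroup Γ} [K.Normal] {C : Set V}
    (hC : G.ConnectedOn C) (hinv : ∀ (g : Γ), ∀ x ∈ C, g • x ∈ C)
    (hlt : ∀ x ∈ C, MulAction.stabilizer Γ x < K) {r : V} (hr : MulAction.stabilizer Γ r = K)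
    (hl : G.Linked C {r}) : K = ⊤ := by
  by_contra hK
  let _ : MulAction Γ C :=
    { smul := fun g x => ⟨g • (x : V), hinv g x x.2⟩
      one_smul := fun x => Subtype.ext (one_smul Γ (x : V))
      mul_smul := fun g h x => Subtype.ext (mul_smul g h (x : V)) }
  have hval : ∀ (g : Γ) (x : C), ((g • x : C) : V) = g • (x : V) := fun _ _ => rfl
  have hG' : (G.induce C).IsInvariant Γ := fun g x y => hG g x y
  have hα' := hα.of_hasMinor (hasMinor_induce C)
  obtain ⟨K', hK'n, π, ⟨u, hu⟩, hπ, hsurj, hfib⟩ := hα'.exists_cayley_contraction hG'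
    (connectedOn_univ_iff.2 (induce_connected_iff_connectedOn.2 hC)) hΓ
  have hK'K : K' < K := by
    convert hlt u u.2 using 1
    rw [hu]
    ext g
    simp only [MulAction.mem_stabilizer_iff, Subtype.ext_iff, hval]
  have hQ := contract_isInvariant hG' hπ
  have hQc := ConnectedOn.contract
    (connectedOn_univ_iff.2 (induce_connected_iff_connectedOn.2 hC)) hsurj
  have hmk : ∀ g : Γ, (g : Γ ⧸ K') ∈ K.map (QuotientGroup.mk' K') ↔ g ∈ K := by
    intro g
    constructor
    · rintro ⟨k, hk, hkg⟩
      have := hK'K.le (QuotientGroup.eq.1 hkg)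
      simpa using K.mul_mem hk this
    · exact fun h => ⟨g, h, rfl⟩
  obtain ⟨g₀, hg₀⟩ : ∃ g, g ∉ K := by
    by_contra! h
    exact hK ((Subgroup.eq_top_iff' K).2 h)
  obtain ⟨a, b, hab, ha, hb⟩ := hQc.exists_adj_boundary
    (P := fun a => a ∈ K.map (QuotientGroup.mk' K')) (Subgroup.one_mem _) (mt (hmk g₀).1 hg₀)
  obtain ⟨s, hs⟩ := QuotientGroup.mk_surjective (a⁻¹ * b)
  have hadj : ((G.induce C).contract π).Adj 1 (s : Γ ⧸ K') := by
    rw [hs]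
    simpa using (hQ a⁻¹ a b).2 hab
  have hsK : s ∉ K := by
    intro h
    rw [← hmk, hs] at h
    exact hb (by simpa using Subgroup.mul_mem _ ha h)
  let d := orderOf (s : Γ ⧸ K)
  have hd : α < d := by
    refine hΓ.lt_of_dvd ((orderOf_dvd_natCard _).trans (Subgroup.card_quotient_dvd_card K)) ?_
    intro h
    exact hsK ((QuotientGroup.eq_one_iff s).1 (orderOf_eq_one_iff.1 h))
  have hpow : ∀ j : ℕ, s ^ j ∈ K ↔ d ∣ j := by
    intro j
    rw [orderOf_dvd_iff_pow_eq_one, ← QuotientGroup.mk_pow, QuotientGroup.eq_one_iff]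
  have hdmin : ∀ j, 0 < j → j < d → (s : Γ ⧸ K') ^ j ∉ K.map (QuotientGroup.mk' K') := by
    intro j hj hjd h
    rw [← QuotientGroup.mk_pow, hmk, hpow] at h
    exact absurd (Nat.le_of_dvd hj h) (by omega)
  have hL : α < Nat.card (K.map (QuotientGroup.mk' K')) := by
    refine hΓ.lt_of_dvd ((Subgroup.card_subgroup_dvd_card _).trans
      (Subgroup.card_quotient_dvd_card K')) ?_
    rw [Ne, Subgroup.card_eq_one]
    intro h
    refine hK'K.not_ge fun k hk => ?_
    have := (hmk k).2 hk
    rw [h, Subgroup.mem_bot, QuotientGroup.eq_one_iff] at this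
    exact this
  obtain ⟨x, hx, r', hr', hxr⟩ := hl
  obtain rfl : r' = r := hr'
  -- translate the edge from `C` to `r` so that it starts in the fibre over the identity
  wlog hx1 : π ⟨x, hx⟩ = 1 generalizing x r'
  · obtain ⟨g, hg⟩ := QuotientGroup.mk_surjective (π ⟨x, hx⟩)
    refine this (x := g⁻¹ • x) (hx := hinv _ _ hx) (r' := g⁻¹ • r') (hxr := (hG _ _ _).2 hxr)
      (hr := ?_) (hx1 := ?_)
    · rw [MulAction.stabilizer_smul_eq_stabilizer_map_conj, hr]
      exact Subgroup.Normal.map_conj_eq _ _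
    · have := hπ g⁻¹ ⟨x, hx⟩
      rw [← hg, ← QuotientGroup.mk_mul, inv_mul_cancel] at this
      exact this
  have hrfix : ∀ k ∈ K, k • r' = r' := fun k hk => by
    rw [← hr] at hk
    exact hk
  have hrC : r' ∉ C := fun h => (hlt _ h).ne hr
  refine hα.no_biclique (X := K.map (QuotientGroup.mk' K')) (Y := Fin d) hL (by simpa using hd)
    (fun a => Subtype.val '' (π ⁻¹' {b | ∃ j < d, b = (a : Γ ⧸ K') * (s : Γ ⧸ K') ^ j}))
    (fun j => {s ^ (j : ℕ) • r'}) (fun a => ?_) (fun j => connectedOn_singleton _) ?_ ?_ ?_ ?_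
  · exact ((connectedOn_segment hQ hadj _ (by omega)).preimage_of_contract hfib).image_val
  · intro a a' hne
    rw [Set.disjoint_left]
    rintro _ ⟨p, ⟨i, hi, hpi⟩, rfl⟩ ⟨p', ⟨j, hj, hpj⟩, hpp⟩
    obtain rfl := Subtype.ext hpp
    exact hne (Subtype.ext (segment_inj hdmin a.2 a'.2 hi hj (hpi.symm.trans hpj)))
  · intro i j hne
    rw [Set.disjoint_singleton]
    intro h
    wlog hij : (i : ℕ) < j generalizing i j
    · exact this j i hne.symm h.symm (by have := Fin.val_ne_of_ne hne; omega)
    have h1 : s ^ ((j : ℕ) - i) ∈ K := by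
      rw [← hr, MulAction.mem_stabilizer_iff]
      apply MulAction.injective (s ^ (i : ℕ))
      simp only
      rw [h, smul_smul, ← pow_add]
      congr 2
      omega
    rw [hpow] at h1
    have := Nat.le_of_dvd (by omega) h1
    omega
  · intro a j
    rw [Set.disjoint_singleton_right]
    rintro ⟨p, -, hp⟩
    refine hrC ?_
    have := hinv (s ^ (j : ℕ))⁻¹ _ p.2
    rwa [hp, inv_smul_smul] at this
  · rintro ⟨_, k, hk, rfl⟩ j
    refine ⟨_, ⟨(k * s ^ (j : ℕ)) • ⟨x, hx⟩, ⟨j, j.2, ?_⟩, rfl⟩, _, rfl, ?_⟩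
    · rw [hπ, hx1]
      simp
    · have : s ^ (j : ℕ) • r' = (k * s ^ (j : ℕ)) • r' := by
        have h1 := hrfix _ (‹K.Normal›.conj_mem k hk (s ^ (j : ℕ))⁻¹)
        rw [inv_inv, mul_smul, mul_smul, inv_smul_eq_iff] at h1
        rw [mul_smul, h1]
      rw [this, hval]
      exact (hG _ _ _).2 hxr

end Action

end SimpleGraph

/-! ### Automorphism groups of vertex-coloured graphs -/

namespace SimpleGraph

section ColorAut

variable {V : Type*} {G : SimpleGraph V} {Q : Type*} {c : V → Q}

/-- The group of automorphisms of `G` that preserve the vertex colouring `c`, which need not be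
proper. -/
def colorAut (G : SimpleGraph V) (c : V → Q) : Subgroup (Equiv.Perm V) where
  carrier := {σ | (∀ x y, G.Adj (σ x) (σ y) ↔ G.Adj x y) ∧ ∀ x, c (σ x) = c x}
  mul_mem' := fun {a b} ha hb => ⟨fun x y => by simp [ha.1, hb.1], fun x => by simp [ha.2, hb.2]⟩
  one_mem' := ⟨fun _ _ => Iff.rfl, fun _ => rfl⟩
  inv_mem' := fun {a} ha => ⟨fun x y => by rw [← ha.1]; simp, fun x => by rw [← ha.2]; simp⟩

theorem colorAut_isInvariant : G.IsInvariant (G.colorAut c) := fun g x y => g.2.1 x y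

/-- The automorphism group of `G`, as the colour-preserving one for a constant colouring. -/
def autMulEquivColorAut (G : SimpleGraph V) (q : Q) :
    (G ≃g G) ≃* G.colorAut (fun _ => q) where
  toFun f := ⟨f.toEquiv, fun _ _ => f.map_rel_iff, fun _ => rfl⟩
  invFun σ := ⟨σ.1, fun {x y} => σ.2.1 x y⟩
  left_inv _ := rfl
  right_inv _ := rfl
  map_mul' _ _ := rfl

/-- If an automorphism `σ` moves a set `C` off itself and fixes all outer neighbours of `C`, then
exchanging `C` with its image and fixing everything else is an automorphism of order two. So this
does not happen in a group of odd order. -/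
theorem not_disjoint_image_of_odd [Finite V] (hodd : PrimeDivisorsGT (G.colorAut c) 2)
    {σ : Equiv.Perm V} (hσ : σ ∈ G.colorAut c) {C : Set V} (hne : C.Nonempty)
    (hC : ∀ x ∈ C, ∀ y, G.Adj x y → y ∈ C ∨ σ y = y) : ¬ Disjoint C (σ '' C) := by
  classical
  intro hdis
  have hdis' : ∀ x, x ∈ C → σ.symm x ∈ C → False := fun x hx hx' =>
    Set.disjoint_left.1 hdis hx ⟨_, hx', by simp⟩
  have hC' : ∀ x, σ.symm x ∈ C → ∀ y, G.Adj x y → σ.symm y ∈ C ∨ σ y = y := by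
    intro x hx y hxy
    rcases hC _ hx (σ.symm y) (by rw [← hσ.1]; simpa using hxy) with h | h
    · exact Or.inl h
    · rw [Equiv.apply_symm_apply] at h
      right
      nth_rewrite 1 [h]
      simp
  let t : V → V := fun x => if x ∈ C then σ x else if σ.symm x ∈ C then σ.symm x else x
  have ht₁ : ∀ x ∈ C, t x = σ x := fun x hx => if_pos hx
  have ht₂ : ∀ x, σ.symm x ∈ C → t x = σ.symm x := fun x hx => by
    simp only [t]
    rw [if_neg fun h => hdis' x h hx, if_pos hx]
  have ht₃ : ∀ x, x ∉ C → σ.symm x ∉ C → t x = x := fun x hx hx' => by simp [t, hx, hx']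
  have hsymm : ∀ x, σ x = x → σ.symm x = x := fun x hx => σ.symm_apply_eq.2 hx.symm
  have hfixC : ∀ x, σ x = x → x ∉ C := fun x hx h => hdis' x h (by rwa [hsymm x hx])
  have hfix : ∀ x, σ x = x → t x = x := fun x hx =>
    ht₃ x (hfixC x hx) (by rw [hsymm x hx]; exact hfixC x hx)
  have htt : Function.Involutive t := by
    intro x
    by_cases h : x ∈ C
    · rw [ht₁ x h, ht₂ _ (by simpa using h)]
      simp
    by_cases h' : σ.symm x ∈ C
    · rw [ht₂ x h', ht₁ _ h']
      simp
    rw [ht₃ x h h', ht₃ x h h']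
  have hadj : ∀ x y, G.Adj x y → G.Adj (t x) (t y) := by
    have key₁ : ∀ x y, x ∈ C → G.Adj x y → G.Adj (t x) (t y) := by
      intro x y hx hxy
      rw [ht₁ x hx]
      rcases hC x hx y hxy with hy | hy
      · rw [ht₁ y hy]
        exact (hσ.1 x y).2 hxy
      · rw [hfix y hy, ← hy]
        exact (hσ.1 x y).2 hxy
    have key₂ : ∀ x y, σ.symm x ∈ C → G.Adj x y → G.Adj (t x) (t y) := by
      intro x y hx hxy
      have hs : G.Adj (σ.symm x) (σ.symm y) := by rw [← hσ.1]; simpa using hxy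
      rw [ht₂ x hx]
      rcases hC' x hx y hxy with hy | hy
      · rwa [ht₂ y hy]
      · rw [hfix y hy]
        rwa [hsymm y hy] at hs
    intro x y hxy
    by_cases hx : x ∈ C
    · exact key₁ x y hx hxy
    by_cases hx' : σ.symm x ∈ C
    · exact key₂ x y hx' hxy
    by_cases hy : y ∈ C
    · exact (key₁ y x hy hxy.symm).symm
    by_cases hy' : σ.symm y ∈ C
    · exact (key₂ y x hy' hxy.symm).symm
    rwa [ht₃ x hx hx', ht₃ y hy hy']
  have hmem : htt.toPerm ∈ G.colorAut c := by
    refine ⟨fun x y => ⟨fun h => ?_, hadj x y⟩, fun x => ?_⟩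
    · simpa [htt x, htt y] using hadj _ _ h
    · change c (t x) = c x
      by_cases h : x ∈ C
      · rw [ht₁ x h, hσ.2]
      by_cases h' : σ.symm x ∈ C
      · rw [ht₂ x h', ← hσ.2]
        simp
      rw [ht₃ x h h']
  have hord : orderOf (⟨htt.toPerm, hmem⟩ : G.colorAut c) = 2 := by
    refine orderOf_eq_prime ?_ ?_
    · ext x
      simp [pow_two, htt x]
    · obtain ⟨x, hx⟩ := hne
      intro h
      have : t x = x := congrArg (fun σ : G.colorAut c => (σ : Equiv.Perm V) x) h
      rw [ht₁ x hx] at this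
      exact hfixC x this hx
  have := hodd 2 Nat.prime_two (hord ▸ orderOf_dvd_natCard _)
  omega

theorem JoinedIn.map_of_mem_colorAut {S : Set V} {σ : Equiv.Perm V} (hσ : σ ∈ G.colorAut c)
    (hS : ∀ x ∈ S, σ x ∈ S) {x y : V} (h : G.JoinedIn S x y) : G.JoinedIn S (σ x) (σ y) :=
  Relation.ReflTransGen.lift σ (fun _ _ h => ⟨hS _ h.1, hS _ h.2.1, (hσ.1 _ _).2 h.2.2⟩) _ _ h

/-- If the automorphisms preserve a union `C` of components, the group is a direct product. -/
theorem nonempty_colorAut_mulEquiv_prod {C : Set V}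
    (hinv : ∀ σ ∈ G.colorAut c, ∀ x, σ x ∈ C ↔ x ∈ C)
    (hC : ∀ x ∈ C, ∀ y ∉ C, ¬ G.Adj x y) :
    Nonempty (G.colorAut c ≃* (G.induce C).colorAut (fun x => c x) ×
      (G.induce Cᶜ).colorAut (fun x => c x)) := by
  classical
  have hinv' : ∀ σ ∈ G.colorAut c, ∀ x, σ x ∈ Cᶜ ↔ x ∈ Cᶜ := fun σ hσ x => not_congr (hinv σ hσ x)
  let f : G.colorAut c →* (G.induce C).colorAut (fun x => c x) ×
      (G.induce Cᶜ).colorAut (fun x => c x) :=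
    { toFun := fun σ =>
        (⟨Equiv.Perm.subtypePerm σ.1 (hinv σ.1 σ.2), fun x y => σ.2.1 x y, fun x => σ.2.2 x⟩,
          ⟨Equiv.Perm.subtypePerm σ.1 (hinv' σ.1 σ.2), fun x y => σ.2.1 x y, fun x => σ.2.2 x⟩)
      map_one' := rfl
      map_mul' := fun _ _ => rfl }
  refine ⟨MulEquiv.ofBijective f ⟨?_, ?_⟩⟩
  · rw [injective_iff_map_eq_one]
    intro σ h
    ext x
    by_cases hx : x ∈ C
    · exact congrArg (fun p => ((p.1.1 ⟨x, hx⟩ : C) : V)) h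
    · exact congrArg (fun p => ((p.2.1 ⟨x, hx⟩ : (Cᶜ : Set V)) : V)) h
  · rintro ⟨⟨σ, hσ⟩, ⟨τ, hτ⟩⟩
    let ρ : Equiv.Perm V := Equiv.Perm.subtypeCongr (p := fun x => x ∈ C) σ τ
    have hρ₁ : ∀ x (hx : x ∈ C), ρ x = σ ⟨x, hx⟩ := fun x hx =>
      Equiv.Perm.subtypeCongr.left_apply _ _ hx
    have hρ₂ : ∀ x (hx : x ∉ C), ρ x = τ ⟨x, hx⟩ := fun x hx =>
      Equiv.Perm.subtypeCongr.right_apply _ _ hx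
    have hρ : ρ ∈ G.colorAut c := by
      refine ⟨fun x y => ?_, fun x => ?_⟩
      · by_cases hx : x ∈ C <;> by_cases hy : y ∈ C
        · rw [hρ₁ x hx, hρ₁ y hy]
          exact hσ.1 ⟨x, hx⟩ ⟨y, hy⟩
        · rw [hρ₁ x hx, hρ₂ y hy]
          exact iff_of_false (hC _ (σ _).2 _ (τ _).2) (hC x hx y hy)
        · rw [hρ₂ x hx, hρ₁ y hy]
          exact iff_of_false (fun h => hC _ (σ _).2 _ (τ _).2 h.symm) fun h => hC y hy x hx h.symm
        · rw [hρ₂ x hx, hρ₂ y hy]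
          exact hτ.1 ⟨x, hx⟩ ⟨y, hy⟩
      · by_cases hx : x ∈ C
        · rw [hρ₁ x hx]
          exact hσ.2 ⟨x, hx⟩
        · rw [hρ₂ x hx]
          exact hτ.2 ⟨x, hx⟩
    refine ⟨⟨ρ, hρ⟩, Prod.ext (Subtype.ext (Equiv.ext fun x => Subtype.ext ?_))
      (Subtype.ext (Equiv.ext fun x => Subtype.ext ?_))⟩
    · exact hρ₁ x x.2
    · exact hρ₂ x x.2

/-- Let `K` be the pointwise stabilizer of an invariant set `R`, and suppose that the vertices
outside `R` are divided equivariantly into pieces indexed by the quotient by `K`, with no edges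
between different pieces. Then the group is the regular wreath product of the automorphism group of
a single piece, with the neighbours in `R` recorded in the colouring, by the quotient. Coset
representatives `q` identify the pieces with each other, and an element `g` acts from piece to piece
by `x ↦ (q x)⁻¹ * g * q (g⁻¹ * x)`. -/
theorem nonempty_colorAut_mulEquiv_wreath {K : Subgroup (G.colorAut c)} [K.Normal] {R : Set V}
    (hR : ∀ (g : G.colorAut c), ∀ x ∈ R, g • x ∈ R)
    (hK : ∀ g, g ∈ K ↔ ∀ r ∈ R, g • r = r) {φ : V → G.colorAut c ⧸ K}
    (hφ : ∀ (g : G.colorAut c), ∀ x ∉ R, φ (g • x) = g * φ x)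
    (hadj : ∀ x ∉ R, ∀ y ∉ R, G.Adj x y → φ x = φ y) :
    Nonempty (G.colorAut c ≃* RegularWreathProduct
      ((G.induce {x | x ∉ R ∧ φ x = 1}).colorAut fun x => (c x, {r | r ∈ R ∧ G.Adj x r}))
      (G.colorAut c ⧸ K)) := by
  classical
  set W : Set V := {x | x ∉ R ∧ φ x = 1} with hW
  have hG : G.IsInvariant (G.colorAut c) := colorAut_isInvariant
  have hR' : ∀ (g : G.colorAut c) x, g • x ∈ R ↔ x ∈ R := fun g x =>
    ⟨fun h => by simpa using hR g⁻¹ _ h, hR g x⟩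
  have hKφ : ∀ k ∈ K, ∀ x, φ (k • x) = φ x := by
    intro k hk x
    by_cases hx : x ∈ R
    · rw [(hK k).1 hk x hx]
    · rw [hφ k x hx, (QuotientGroup.eq_one_iff k).2 hk, one_mul]
  have hKW : ∀ k ∈ K, ∀ x, k • x ∈ W ↔ x ∈ W := fun k hk x => by
    simp only [hW, Set.mem_ofPred_eq, hR', hKφ k hk]
  have hKadj : ∀ k ∈ K, ∀ x, ∀ r ∈ R, G.Adj (k • x) r ↔ G.Adj x r := fun k hk x r hr => by
    rw [← hG k x r, (hK k).1 hk r hr]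
  let M := (G.induce W).colorAut fun x => (c x, {r | r ∈ R ∧ G.Adj x r})
  let res : K →* M :=
    { toFun := fun k => ⟨Equiv.Perm.subtypePerm (k.1.1) (hKW k.1 k.2),
        fun x y => k.1.2.1 x y, fun x => Prod.ext (k.1.2.2 x) (Set.ext fun r =>
          and_congr_right fun hr => hKadj k.1 k.2 x r hr)⟩
      map_one' := rfl
      map_mul' := fun _ _ => rfl }
  have hres : ∀ (k : K) (x : W), (((res k).1 x : W) : V) = (k : G.colorAut c) • (x : V) :=
    fun _ _ => rfl
  -- extend by the identity outside the piece `W`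
  have hext : ∀ m : M, ∃ k : K, res k = m := by
    rintro ⟨m, hm⟩
    let e : Equiv.Perm V := Equiv.Perm.ofSubtype m
    have he₁ : ∀ x (hx : x ∈ W), e x = m ⟨x, hx⟩ := fun x hx =>
      Equiv.Perm.ofSubtype_apply_of_mem m hx
    have he₂ : ∀ x, x ∉ W → e x = x := fun x hx => Equiv.Perm.ofSubtype_apply_of_not_mem m hx
    have key : ∀ (x : W), ∀ y ∉ W, G.Adj (m x) y ↔ G.Adj x y := by
      intro x y hy
      by_cases hyR : y ∈ R
      · have := congrArg Prod.snd (hm.2 x)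
        have := Set.ext_iff.1 this y
        simpa [hyR] using this
      · refine iff_of_false (fun h => hy ⟨hyR, ?_⟩) (fun h => hy ⟨hyR, ?_⟩)
        · rw [← hadj _ (m x).2.1 y hyR h, (m x).2.2]
        · rw [← hadj _ x.2.1 y hyR h, x.2.2]
    have he : e ∈ G.colorAut c := by
      refine ⟨fun x y => ?_, fun x => ?_⟩
      · by_cases hx : x ∈ W <;> by_cases hy : y ∈ W
        · rw [he₁ x hx, he₁ y hy]
          exact hm.1 ⟨x, hx⟩ ⟨y, hy⟩
        · rw [he₁ x hx, he₂ y hy]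
          exact key ⟨x, hx⟩ y hy
        · rw [he₂ x hx, he₁ y hy, G.adj_comm, G.adj_comm x]
          exact key ⟨y, hy⟩ x hx
        · rw [he₂ x hx, he₂ y hy]
      · by_cases hx : x ∈ W
        · rw [he₁ x hx]
          exact congrArg Prod.fst (hm.2 ⟨x, hx⟩)
        · rw [he₂ x hx]
    refine ⟨⟨⟨e, he⟩, (hK _).2 fun r hr => he₂ r fun h => h.1 hr⟩, ?_⟩
    refine Subtype.ext (Equiv.ext fun x => Subtype.ext ?_)
    exact he₁ x x.2
  choose ext hextres using hext
  -- elements of `K` can be prescribed independently on the pieces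
  have hglue : ∀ κ : G.colorAut c ⧸ K → K, ∃ k ∈ K, ∀ x, k • x = (κ (φ x) : G.colorAut c) • x := by
    intro κ
    have hinv : ∀ κ : G.colorAut c ⧸ K → K, Function.LeftInverse
        (fun x => ((κ (φ x))⁻¹ : G.colorAut c) • x) (fun x => (κ (φ x) : G.colorAut c) • x) := by
      intro κ x
      simp only [hKφ _ (κ (φ x)).2, inv_smul_smul]
    let t : Equiv.Perm V := ⟨fun x => (κ (φ x) : G.colorAut c) • x,
      fun x => ((κ (φ x))⁻¹ : G.colorAut c) • x, hinv κ,
      fun x => by simpa using hinv (fun a => (κ a)⁻¹) x⟩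
    have ht : t ∈ G.colorAut c := by
      refine ⟨fun x y => ?_, fun x => (κ (φ x) : G.colorAut c).2.2 x⟩
      change G.Adj ((κ (φ x) : G.colorAut c) • x) ((κ (φ y) : G.colorAut c) • y) ↔ _
      by_cases hx : x ∈ R
      · rw [(hK _).1 (κ (φ x)).2 x hx, G.adj_comm, G.adj_comm x]
        exact hKadj _ (κ (φ y)).2 y x hx
      by_cases hy : y ∈ R
      · rw [(hK _).1 (κ (φ y)).2 y hy]
        exact hKadj _ (κ (φ x)).2 x y hy
      by_cases hxy : φ x = φ y
      · rw [hxy]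
        exact hG _ x y
      · refine iff_of_false (fun h => hxy ?_) fun h => hxy (hadj x hx y hy h)
        have := hadj _ (mt (hR' _ _).1 hx) _ (mt (hR' _ _).1 hy) h
        rwa [hKφ _ (κ (φ x)).2, hKφ _ (κ (φ y)).2] at this
    refine ⟨⟨t, ht⟩, (hK _).2 fun r hr => ?_, fun x => rfl⟩
    exact (hK _).1 (κ (φ r)).2 r hr
  choose q hq using fun a : G.colorAut c ⧸ K => QuotientGroup.mk_surjective a
  have hmem : ∀ (g : G.colorAut c) (x : G.colorAut c ⧸ K),
      (q x)⁻¹ * g * q ((g : G.colorAut c ⧸ K)⁻¹ * x) ∈ K := by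
    intro g x
    rw [← QuotientGroup.eq_one_iff, QuotientGroup.mk_mul, QuotientGroup.mk_mul,
      QuotientGroup.mk_inv, hq, hq]
    group
  let Ψ : G.colorAut c →* RegularWreathProduct M (G.colorAut c ⧸ K) :=
    MonoidHom.mk' (fun g => ⟨fun x => res ⟨_, hmem g x⟩, g⟩) (by
      intro g h
      refine RegularWreathProduct.ext (funext fun x => ?_) rfl
      simp only [RegularWreathProduct.mul_left, Pi.mul_apply]
      rw [← map_mul]
      refine congrArg res (Subtype.ext ?_)
      have : ((g * h : G.colorAut c) : G.colorAut c ⧸ K)⁻¹ * x =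
          (h : G.colorAut c ⧸ K)⁻¹ * ((g : G.colorAut c ⧸ K)⁻¹ * x) := by
        rw [QuotientGroup.mk_mul]; group
      simp only [Subgroup.coe_mul, this]
      group)
  have hqW : ∀ x ∉ R, (q (φ x))⁻¹ • x ∈ W := fun x hx =>
    ⟨mt (hR' _ _).1 hx, by rw [hφ _ x hx, QuotientGroup.mk_inv, hq, inv_mul_cancel]⟩
  refine ⟨MulEquiv.ofBijective Ψ ⟨?_, ?_⟩⟩
  · rw [injective_iff_map_eq_one]
    intro g hg
    have hg1 : (g : G.colorAut c ⧸ K) = 1 := congrArg RegularWreathProduct.right hg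
    have hgK := (QuotientGroup.eq_one_iff g).1 hg1
    refine Subtype.ext (Equiv.ext fun x => ?_)
    change g • x = x
    by_cases hx : x ∈ R
    · exact (hK g).1 hgK x hx
    · have h1 : res ⟨_, hmem g (φ x)⟩ = 1 :=
        congrFun (congrArg RegularWreathProduct.left hg) (φ x)
      have h2 := hres ⟨_, hmem g (φ x)⟩ ⟨_, hqW x hx⟩
      rw [h1] at h2
      have h3 : (q (φ x))⁻¹ • x = (q (φ x))⁻¹ • g • x := by
        simpa [hg1, mul_smul] using h2
      exact (MulAction.injective _ h3).symm
  · have hker : ∀ m : G.colorAut c ⧸ K → M, ∃ g, Ψ g = ⟨m, 1⟩ := by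
      intro m
      obtain ⟨k, hk, hkx⟩ := hglue fun x => ⟨q x * ext (m x) * (q x)⁻¹,
        ‹K.Normal›.conj_mem _ (ext (m x)).2 _⟩
      have hk1 : (k : G.colorAut c ⧸ K) = 1 := (QuotientGroup.eq_one_iff k).2 hk
      refine ⟨k, RegularWreathProduct.ext (funext fun x => ?_) hk1⟩
      change res ⟨_, hmem k x⟩ = m x
      rw [← hextres (m x)]
      refine Subtype.ext (Equiv.ext fun w => Subtype.ext ?_)
      rw [hres, hres]
      have hφw : φ (q x • (w : V)) = x := by rw [hφ _ _ w.2.1, w.2.2, hq, mul_one]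
      have := hkx (q x • (w : V))
      simp only [hφw, mul_smul, inv_smul_smul] at this
      simp only [hk1, inv_one, one_mul, mul_smul, this, inv_smul_smul]
    rintro ⟨m, t⟩
    obtain ⟨g, hg⟩ := hker (m * (Ψ (q t)).left⁻¹)
    refine ⟨g * q t, ?_⟩
    rw [map_mul, hg]
    refine RegularWreathProduct.ext (funext fun x => ?_) ?_
    · simp
    · rw [RegularWreathProduct.mul_right, one_mul]
      exact hq t

end ColorAut

end SimpleGraph

/-! ### The structure of automorphism groups of odd order -/

namespace SimpleGraph

section Structure

variable {V : Type*} {G : SimpleGraph V} {Q : Type*} {c : V → Q}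

/-- In the connected case there are a normal subgroup `K` with abelian quotient, a nonempty set `R`
with pointwise stabilizer `K`, and an equivariant indexing of the components outside `R` by the
quotient by `K`. Here `K` is the largest vertex stabilizer and `R` the set of vertices with
stabilizer `K`. -/
theorem MinorDegreeLE.exists_piece_indexing [Finite V] {α : ℕ} (hα : G.MinorDegreeLE α)
    (hconn : G.ConnectedOn Set.univ) (hΓ : PrimeDivisorsGT (G.colorAut c) (max α 2)) :
    ∃ (K : Subgroup (G.colorAut c)) (_ : K.Normal) (R : Set V) (φ : V → G.colorAut c ⧸ K),
      (∀ a b : G.colorAut c ⧸ K, a * b = b * a) ∧ R.Nonempty ∧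
      (∀ (g : G.colorAut c), ∀ x ∈ R, g • x ∈ R) ∧ (∀ g, g ∈ K ↔ ∀ r ∈ R, g • r = r) ∧
      (∀ (g : G.colorAut c), ∀ x ∉ R, φ (g • x) = g * φ x) ∧
      (∀ x ∉ R, ∀ y ∉ R, G.Adj x y → φ x = φ y) := by
  classical
  have hG : G.IsInvariant (G.colorAut c) := colorAut_isInvariant
  have hΓα : PrimeDivisorsGT (G.colorAut c) α := fun p hp hd =>
    (le_max_left _ _).trans_lt (hΓ p hp hd)
  have hΓ2 : PrimeDivisorsGT (G.colorAut c) 2 := fun p hp hd =>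
    (le_max_right _ _).trans_lt (hΓ p hp hd)
  obtain ⟨K, hKn, π, ⟨v₀, hv₀⟩, hπ, hsurj, hfib⟩ := hα.exists_cayley_contraction hG hconn hΓα
  let R : Set V := {x : V | MulAction.stabilizer (G.colorAut c) x = K}
  have hle : ∀ x : V, MulAction.stabilizer (G.colorAut c) x ≤ K := by
    intro x g hg
    have := hπ g x
    rw [MulAction.mem_stabilizer_iff.1 hg] at this
    exact (QuotientGroup.eq_one_iff g).1 (mul_eq_right.1 this.symm)
  have hR : ∀ (g : G.colorAut c), ∀ x ∈ R, g • x ∈ R := by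
    intro g x hx
    change MulAction.stabilizer (G.colorAut c) (g • x) = K
    rw [MulAction.stabilizer_smul_eq_stabilizer_map_conj, show MulAction.stabilizer _ x = K from hx]
    exact Subgroup.Normal.map_conj_eq _ _
  have hRc : ∀ (g : G.colorAut c), ∀ x ∈ Rᶜ, g • x ∈ Rᶜ := fun g x hx h =>
    hx (by simpa using hR g⁻¹ _ h)
  have hKR : ∀ g ∈ K, ∀ r ∈ R, g • r = r := by
    intro g hg r hr
    rw [← show MulAction.stabilizer _ r = K from hr] at hg
    exact hg
  have hJ : ∀ (g : G.colorAut c) {x y}, G.JoinedIn Rᶜ x y → G.JoinedIn Rᶜ (g • x) (g • y) :=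
    fun g _ _ h => h.map_of_mem_colorAut g.2 (hRc g)
  -- `K` preserves the components outside `R`, as the group has odd order
  have hKcomp : ∀ k ∈ K, ∀ x ∉ R, G.JoinedIn Rᶜ x (k • x) := by
    intro k hk x hx
    have := not_disjoint_image_of_odd hΓ2 k.2 (C := {y | G.JoinedIn Rᶜ x y}) ⟨x, .refl x⟩ (by
      intro y hy z hyz
      by_cases hz : z ∈ R
      · exact Or.inr (hKR k hk z hz)
      · exact Or.inl (JoinedIn.trans hy (.of_adj (JoinedIn.mem hy hx) hz hyz)))
    obtain ⟨_, hz, y, hy, rfl⟩ := Set.not_disjoint_iff.1 this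
    exact JoinedIn.trans hz (hJ k hy).symm
  -- conversely an element preserving such a component lies in `K`
  have hcompK : ∀ (g : G.colorAut c), ∀ x ∉ R, G.JoinedIn Rᶜ x (g • x) → g ∈ K := by
    intro g x hx hgx
    let C : Set V := {y | G.JoinedIn Rᶜ x y}
    let H : Subgroup (G.colorAut c) :=
      { carrier := {g | G.JoinedIn Rᶜ x (g • x)}
        mul_mem' := fun {a b} ha hb => by
          change G.JoinedIn Rᶜ x ((a * b) • x)
          rw [mul_smul]
          exact JoinedIn.trans ha (hJ a hb)
        one_mem' := by
          change G.JoinedIn Rᶜ x ((1 : G.colorAut c) • x)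
          rw [one_smul]
          exact .refl x
        inv_mem' := fun {a} ha => by
          have := hJ a⁻¹ ha
          rw [inv_smul_smul] at this
          exact this.symm }
    have hKH : K ≤ H := fun k hk => hKcomp k hk x hx
    have hCR : ∀ y ∈ C, y ∉ R := fun y hy => JoinedIn.mem hy hx
    have hCconn : G.ConnectedOn C := by
      refine .of_root (x := x) (.refl x) fun y hy => ?_
      have : ∀ y, G.JoinedIn Rᶜ x y → G.JoinedIn C x y := by
        intro y hy
        induction hy with
        | refl => exact .refl x
        | tail h h' ih =>
          exact ih.trans (.of_adj h (JoinedIn.trans h (.of_adj h'.1 h'.2.1 h'.2.2)) h'.2.2)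
      exact this y hy
    have hv₀R : v₀ ∈ R := hv₀.symm
    obtain ⟨a, r, har, ha, hr⟩ := hconn.exists_adj_boundary (P := fun y => y ∈ C) (x := x) (y := v₀)
      (.refl x) fun h => hCR _ h hv₀R
    have hrR : r ∈ R := by
      by_contra hrR
      exact hr (JoinedIn.trans ha (.of_adj (hCR a ha) hrR har))
    have hstab : ∀ y : V, MulAction.stabilizer H y =
        (MulAction.stabilizer (G.colorAut c) y).subgroupOf H := fun y => by
      ext h
      rfl
    have := hα.eq_top_of_invariant_connectedOn (Γ := H) (K := K.subgroupOf H) (C := C) (r := r)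
      (fun h => hG h) (hΓα.of_dvd (Subgroup.card_subgroup_dvd_card H)) hCconn
      (fun h y hy => JoinedIn.trans h.2 (hJ h.1 hy))
      (fun y hy => by
        rw [hstab]
        refine lt_of_le_of_ne (Subgroup.subgroupOf_mono H (hle y)) fun h => hCR y hy ?_
        rw [Subgroup.subgroupOf_inj, inf_eq_left.2 hKH, inf_eq_left.2 ((hle y).trans hKH)] at h
        exact h)
      (by rw [hstab, show MulAction.stabilizer _ r = K from hrR]) ⟨a, ha, r, rfl, har⟩
    exact Subgroup.subgroupOf_eq_top.1 this hgx
  let S : Setoid V :=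
    { r := fun x y => ∃ g : G.colorAut c, G.JoinedIn Rᶜ (g • x) y
      iseqv :=
        { refl := fun x => ⟨1, by rw [one_smul]; exact .refl x⟩
          symm := fun {x y} ⟨g, hg⟩ => ⟨g⁻¹, by simpa using (hJ g⁻¹ hg).symm⟩
          trans := fun {x y z} ⟨g, hg⟩ ⟨h, hh⟩ => ⟨h * g, by
            rw [mul_smul]
            exact (hJ h hg).trans hh⟩ } }
  let rep : V → V := fun x => (Quotient.mk S x).out
  have hrep : ∀ x, ∃ g : G.colorAut c, G.JoinedIn Rᶜ (g • rep x) x := fun x => Quotient.mk_out x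
  choose q hq using hrep
  have hrepR : ∀ x ∉ R, rep x ∉ R := fun x hx h => (hq x).symm.mem hx (hR _ _ h)
  have hspec : ∀ x ∉ R, ∀ g : G.colorAut c, G.JoinedIn Rᶜ (g • rep x) x →
      ((q x : G.colorAut c) : G.colorAut c ⧸ K) = g := by
    intro x hx g hg
    rw [QuotientGroup.eq]
    refine hcompK _ (rep x) (hrepR x hx) ?_
    simpa [mul_smul] using hJ (q x)⁻¹ ((hq x).trans hg.symm)
  have hrep_eq : ∀ x y, (∃ g : G.colorAut c, G.JoinedIn Rᶜ (g • x) y) → rep x = rep y :=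
    fun x y h => congrArg Quotient.out (Quotient.sound (s := S) h)
  refine ⟨K, hKn, R, fun x => (q x : G.colorAut c ⧸ K), ?_, ⟨v₀, hv₀.symm⟩, hR, fun g =>
    ⟨hKR g, fun h => ?_⟩, fun g x hx => ?_, fun x hx y hy hxy => ?_⟩
  · exact (hα.of_hasMinor (hasMinor_contract hfib)).mul_comm (contract_isInvariant hG hπ)
      (hconn.contract hsurj) (hΓα.of_dvd (Subgroup.card_quotient_dvd_card K))
  · rw [hv₀]
    exact h v₀ hv₀.symm
  · refine hspec (g • x) (hRc g x hx) (g * q x) ?_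
    rw [← hrep_eq x (g • x) ⟨g, .refl _⟩, mul_smul]
    exact hJ g (hq x)
  · refine (hspec y hy (q x) ?_).symm
    have hxy' : G.JoinedIn Rᶜ x y := .of_adj hx hy hxy
    rw [← hrep_eq x y ⟨1, by rwa [one_smul]⟩]
    exact (hq x).trans hxy'

end Structure

/-- Induction on the number of vertices. A disconnected graph gives a direct product and a connected
graph a wreath product with abelian top group; the pieces that remain are induced subgraphs with a
refined colouring. -/
theorem MinorDegreeLE.isAbelianProductWreath_colorAut {α : ℕ} {V : Type u} [Finite V] {Q : Type u}
    {G : SimpleGraph V} {c : V → Q} (hα : G.MinorDegreeLE α)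
    (hΓ : PrimeDivisorsGT (G.colorAut c) (max α 2)) : IsAbelianProductWreath (G.colorAut c) := by
  induction hn : Nat.card V using Nat.strong_induction_on generalizing V Q with
  | _ n ih =>
    subst hn
    rcases isEmpty_or_nonempty V with hV | ⟨⟨x₀⟩⟩
    · exact .abelian _ fun _ _ => Subsingleton.elim _ _
    have hΓ2 : PrimeDivisorsGT (G.colorAut c) 2 := fun p hp hd =>
      (le_max_right _ _).trans_lt (hΓ p hp hd)
    have hlt : ∀ W : Set V, W ≠ Set.univ → Nat.card W < Nat.card V := fun W hW => by
      have := Set.ncard_lt_ncard (Set.ssubset_univ_iff.2 hW) (Set.toFinite _)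
      rwa [Set.ncard_univ] at this
    by_cases hconn : G.ConnectedOn Set.univ
    · obtain ⟨K, hK, R, φ, hcomm, ⟨r, hr⟩, hR, hKR, hφ, hadj⟩ := hα.exists_piece_indexing hconn hΓ
      obtain ⟨e⟩ := nonempty_colorAut_mulEquiv_wreath hR hKR hφ hadj
      refine .of_mulEquiv _ _ e.symm (.wreath _ _ ?_ (.abelian _ hcomm))
      refine ih _ (hlt _ fun h => ?_) (hα.of_hasMinor (hasMinor_induce _)) (hΓ.of_dvd ?_) rfl
      · have : r ∈ {x | x ∉ R ∧ φ x = 1} := h ▸ Set.mem_univ r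
        exact this.1 hr
      · rw [Nat.card_congr e.toEquiv, RegularWreathProduct.card]
        exact (dvd_pow_self _ Nat.card_pos.ne').mul_right _
    · let C : Set V := {y | G.JoinedIn Set.univ x₀ y}
      have hmap : ∀ σ ∈ G.colorAut c, ∀ x ∈ C, σ x ∈ C := by
        intro σ hσ x hx
        have := not_disjoint_image_of_odd hΓ2 hσ (C := C) ⟨x₀, .refl _⟩
          fun y hy z hyz => Or.inl (JoinedIn.trans hy (.of_adj trivial trivial hyz))
        obtain ⟨_, hz, y, hy, rfl⟩ := Set.not_disjoint_iff.1 this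
        have hyx : G.JoinedIn Set.univ y x := JoinedIn.trans (JoinedIn.symm hy) hx
        exact JoinedIn.trans hz (hyx.map_of_mem_colorAut hσ fun _ _ => Set.mem_univ _)
      obtain ⟨e⟩ := nonempty_colorAut_mulEquiv_prod (G := G) (c := c) (C := C)
        (fun σ hσ x => ⟨fun h => by simpa using hmap σ⁻¹ (inv_mem hσ) _ h, hmap σ hσ x⟩)
        fun x hx y hy hxy => hy (JoinedIn.trans hx (.of_adj trivial trivial hxy))
      have hcard : Nat.card (G.colorAut c) = _ :=
        (Nat.card_congr e.toEquiv).trans (Nat.card_prod _ _)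
      refine .of_mulEquiv _ _ e.symm (.prod _ _ ?_ ?_)
      · refine ih _ (hlt C fun h => hconn ?_) (hα.of_hasMinor (hasMinor_induce _))
          (hΓ.of_dvd (hcard ▸ dvd_mul_right _ _)) rfl
        exact .of_root (x := x₀) trivial fun y _ => h.ge (Set.mem_univ y)
      · refine ih _ (hlt Cᶜ fun h => ?_) (hα.of_hasMinor (hasMinor_induce _))
          (hΓ.of_dvd (hcard ▸ dvd_mul_left _ _)) rfl
        exact h.ge (Set.mem_univ x₀) (JoinedIn.refl x₀)

end SimpleGraph

/-! ### Dense minors -/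

namespace SimpleGraph

section DenseMinor

variable {V : Type*} {G : SimpleGraph V}

theorem ncard_edgeSet_le_delete_vertex [Finite V] (y : V) :
    G.edgeSet.ncard ≤ (G.induce {y}ᶜ).edgeSet.ncard + (G.neighborSet y).ncard := by
  have : G.edgeSet ⊆ Sym2.map Subtype.val '' (G.induce {y}ᶜ).edgeSet ∪
      (fun z => s(y, z)) '' G.neighborSet y := by
    intro e
    induction e with
    | _ a b =>
      intro h
      rw [mem_edgeSet] at h
      by_cases ha : a = y
      · subst ha
        exact Or.inr ⟨b, h, rfl⟩
      by_cases hb : b = y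
      · subst hb
        exact Or.inr ⟨a, h.symm, Sym2.eq_swap⟩
      exact Or.inl ⟨s(⟨a, ha⟩, ⟨b, hb⟩), h, rfl⟩
  refine (Set.ncard_le_ncard this (Set.toFinite _)).trans ((Set.ncard_union_le _ _).trans ?_)
  exact add_le_add (Set.ncard_image_le (Set.toFinite _)) (Set.ncard_image_le (Set.toFinite _))

/-- Contracting an edge loses that edge and one further edge for every common neighbour. -/
theorem exists_minor_contract_edge [Finite V] {x y : V} (hxy : G.Adj x y) :
    ∃ H : SimpleGraph ({y}ᶜ : Set V), G.HasMinor H ∧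
      G.edgeSet.ncard ≤ H.edgeSet.ncard + ((G.neighborSet x ∩ G.neighborSet y).ncard + 1) := by
  classical
  have hxy' : x ∈ ({y}ᶜ : Set V) := hxy.ne
  let B : ({y}ᶜ : Set V) → Set V := fun z => if (z : V) = x then {x, y} else {(z : V)}
  have hB : ∀ z, (z : V) ∈ B z := fun z => by
    by_cases h : (z : V) = x <;> simp [B, h]
  have hBy : y ∈ B ⟨x, hxy'⟩ := by simp [B]
  let H : SimpleGraph ({y}ᶜ : Set V) :=
    { Adj := fun a b => a ≠ b ∧ G.Linked (B a) (B b)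
      symm := ⟨fun _ _ h => ⟨h.1.symm, h.2.symm⟩⟩
      loopless := ⟨fun _ h => h.1 rfl⟩ }
  have hminor : G.HasMinor H := by
    refine hasMinor_iff.2 ⟨B, fun z => ?_, fun z w hzw => ?_, fun _ _ h => h.2⟩
    · by_cases h : (z : V) = x
      · simp only [B, h, if_true]
        refine .of_root (x := x) (by simp) ?_
        rintro _ (rfl | rfl)
        · exact .refl _
        · exact .of_adj (by simp) (by simp) hxy
      · simp only [B, h, if_false]
        exact connectedOn_singleton _
    · rw [Set.disjoint_left]
      intro p hp hp'
      refine hzw (Subtype.ext ?_)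
      have hz : (z : V) ≠ y := z.2
      have hw : (w : V) ≠ y := w.2
      simp only [B] at hp hp'
      split_ifs at hp hp' with h1 h2 h2 <;> grind
  have : G.edgeSet ⊆ insert s(x, y) ((fun z => s(y, z)) '' (G.neighborSet x ∩ G.neighborSet y)) ∪
      (fun e : Sym2 ({y}ᶜ : Set V) => if e.map Subtype.val ∈ G.edgeSet then e.map Subtype.val
        else e.map fun z : ({y}ᶜ : Set V) => if (z : V) = x then y else (z : V)) '' H.edgeSet := by
    have key : ∀ b, G.Adj y b → s(y, b) ∈
        insert s(x, y) ((fun z => s(y, z)) '' (G.neighborSet x ∩ G.neighborSet y)) ∪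
      (fun e : Sym2 ({y}ᶜ : Set V) => if e.map Subtype.val ∈ G.edgeSet then e.map Subtype.val
        else e.map fun z : ({y}ᶜ : Set V) => if (z : V) = x then y else (z : V)) '' H.edgeSet := by
      intro b h
      by_cases hbx : b = x
      · subst hbx
        exact Or.inl (Or.inl Sym2.eq_swap)
      by_cases hb : G.Adj x b
      · exact Or.inl (Or.inr ⟨b, ⟨hb, h⟩, rfl⟩)
      · refine Or.inr ⟨s(⟨x, hxy'⟩, ⟨b, h.ne'⟩), ?_, ?_⟩
        · exact ⟨fun h => hbx (congrArg Subtype.val h).symm, y, hBy, b, hB ⟨b, _⟩, h⟩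
        · simp [hb, hbx]
    intro e
    induction e with
    | _ a b =>
      intro h
      rw [mem_edgeSet] at h
      by_cases ha : a = y
      · subst ha
        exact key b h
      by_cases hb : b = y
      · subst hb
        have hs : s(a, b) = s(b, a) := Sym2.eq_swap
        rw [hs]
        exact key a h.symm
      refine Or.inr ⟨s(⟨a, ha⟩, ⟨b, hb⟩), ?_, ?_⟩
      · exact ⟨fun h' => h.ne (congrArg Subtype.val h'), a, hB ⟨a, _⟩, b, hB ⟨b, _⟩, h⟩
      · simp [h]
  refine ⟨H, hminor, ?_⟩
  refine (Set.ncard_le_ncard this (Set.toFinite _)).trans ((Set.ncard_union_le _ _).trans ?_)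
  rw [add_comm]
  refine add_le_add (Set.ncard_image_le (Set.toFinite _)) ((Set.ncard_insert_le _ _).trans ?_)
  exact add_le_add (Set.ncard_image_le (Set.toFinite _)) le_rfl

theorem ncard_neighborSet_induce {s : Set V} (x : s) :
    ((G.induce s).neighborSet x).ncard = (G.neighborSet x ∩ s).ncard := by
  rw [← Set.ncard_image_of_injective _ Subtype.val_injective]
  congr 1
  ext y
  simp only [Set.mem_image, mem_neighborSet, Set.mem_inter_iff]
  constructor
  · rintro ⟨z, hz, rfl⟩
    exact ⟨hz, z.2⟩
  · rintro ⟨hy, hs⟩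
    exact ⟨⟨y, hs⟩, hy, rfl⟩

theorem exists_ncard_neighborSet_le [Finite V] [Nonempty V] {d : ℕ}
    (h : G.edgeSet.ncard ≤ d * Nat.card V) : ∃ v, (G.neighborSet v).ncard ≤ 2 * d := by
  classical
  have := Fintype.ofFinite V
  by_contra! hcon
  have hs := G.sum_degrees_eq_twice_card_edges
  have hd : ∀ v, G.degree v = (G.neighborSet v).ncard := fun v => by
    rw [← card_neighborSet_eq_degree, ← Nat.card_eq_fintype_card]
    rfl
  have he : G.edgeFinset.card = G.edgeSet.ncard := by
    rw [← coe_edgeFinset, Set.ncard_coe_finset]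
  have : ∑ v : V, 2 * d < ∑ v : V, G.degree v :=
    Finset.sum_lt_sum_of_nonempty Finset.univ_nonempty fun v _ => by rw [hd]; exact hcon v
  rw [hs, he, Finset.sum_const, Finset.card_univ, ← Nat.card_eq_fintype_card, smul_eq_mul] at this
  nlinarith

/-- A graph with `n` vertices and at least `d * n` edges has a minor on at most `2 * d` vertices of
minimum degree at least `d`. In a minimal such graph there are exactly `d * n` edges, so some vertex
has at most `2 * d` neighbours, and no edge can be contracted, so each of these neighbours has at
least `d` neighbours among the others. -/
theorem exists_minor_minDegree {d : ℕ} (hd : 1 ≤ d) {V : Type u} [Finite V] [Nonempty V]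
    {G : SimpleGraph V} (h : d * Nat.card V ≤ G.edgeSet.ncard) :
    ∃ (W : Type u) (_ : Finite W) (_ : Nonempty W) (H : SimpleGraph W), G.HasMinor H ∧
      Nat.card W ≤ 2 * d ∧ ∀ w, d ≤ (H.neighborSet w).ncard := by
  induction hn : Nat.card V + G.edgeSet.ncard using Nat.strong_induction_on generalizing V with
  | _ n ih =>
    subst hn
    have hVpos : 0 < Nat.card V := Nat.card_pos
    have hEpos : 0 < G.edgeSet.ncard := lt_of_lt_of_le (Nat.mul_pos hd hVpos) h
    have hcompl : ∀ y : V, Nat.card ({y}ᶜ : Set V) = Nat.card V - 1 := fun y => by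
      rw [Nat.card_coe_set_eq, Set.ncard_compl, Set.ncard_singleton]
    have hmul : d * (Nat.card V - 1) + d = d * Nat.card V := by
      rw [← Nat.mul_succ]
      congr 1
      omega
    rcases h.lt_or_eq with hlt | heq
    · -- delete an edge
      obtain ⟨e, he⟩ := (Set.ncard_pos (Set.toFinite _)).1 hEpos
      have hdel : (G.deleteEdges {e}).edgeSet.ncard = G.edgeSet.ncard - 1 := by
        rw [edgeSet_deleteEdges, Set.ncard_sdiff_singleton_of_mem he]
      obtain ⟨W, hW, hW', H, hH, h1, h2⟩ := ih _ (by omega) (G := G.deleteEdges {e})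
        (by omega) rfl
      refine ⟨W, hW, hW', H, HasMinor.trans ?_ hH, h1, h2⟩
      exact hasMinor_of_injective id Function.injective_id fun x y hxy => deleteEdges_le _ hxy
    obtain ⟨v, hv⟩ := exists_ncard_neighborSet_le heq.ge
    by_cases hv0 : (G.neighborSet v).ncard = 0
    · -- delete the isolated vertex `v`
      have hle := ncard_edgeSet_le_delete_vertex (G := G) v
      have : Nonempty ({v}ᶜ : Set V) := by
        by_contra hempty
        have := Nat.card_eq_zero.2 (Or.inl (not_nonempty_iff.1 hempty))
        obtain ⟨e, he⟩ := (Set.ncard_pos (Set.toFinite _)).1 hEpos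
        induction e with
        | _ a b =>
          have hab : G.Adj a b := he
          by_cases ha : a = v
          · exact hempty ⟨b, fun hb => hab.ne (ha.trans (Set.mem_singleton_iff.1 hb).symm)⟩
          · exact hempty ⟨a, ha⟩
      have h' := hcompl v
      have hle' : (G.induce {v}ᶜ).edgeSet.ncard ≤ G.edgeSet.ncard := by
        rw [← Set.ncard_image_of_injective _ (Sym2.map.injective Subtype.val_injective)]
        refine Set.ncard_le_ncard ?_ (Set.toFinite _)
        rintro _ ⟨e, he, rfl⟩
        induction e with
        | _ a b => exact he
      obtain ⟨W, hW, hW', H, hH, h1, h2⟩ := ih _ (by omega) (G := G.induce {v}ᶜ)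
        (by rw [h']; omega) rfl
      exact ⟨W, hW, hW', H, (hasMinor_induce _).trans hH, h1, h2⟩
    by_cases hcodeg : ∃ u, G.Adj u v ∧ (G.neighborSet u ∩ G.neighborSet v).ncard < d
    · obtain ⟨u, huv, hc⟩ := hcodeg
      obtain ⟨K, hK, hKe⟩ := exists_minor_contract_edge huv
      have h' := hcompl v
      have : Nonempty ({v}ᶜ : Set V) := ⟨u, huv.ne⟩
      -- the induction needs fewer vertices plus edges, so surplus edges of the minor are dropped
      obtain ⟨E, hE, hEc⟩ := Set.exists_subset_card_eq
        (s := K.edgeSet) (n := d * (Nat.card V - 1)) (by omega)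
      have hK' : (K.deleteEdges Eᶜ).edgeSet = E := by
        rw [edgeSet_deleteEdges, Set.sdiff_compl, Set.inter_eq_right.2 hE]
      obtain ⟨W, hW, hW', H, hH, h1, h2⟩ := ih _ (by rw [hK', hEc]; omega)
        (G := K.deleteEdges Eᶜ) (by rw [h', hK', hEc]) rfl
      refine ⟨W, hW, hW', H, (hK.trans ?_).trans hH, h1, h2⟩
      exact hasMinor_of_injective id Function.injective_id fun x y hxy => deleteEdges_le _ hxy
    · push Not at hcodeg
      refine ⟨G.neighborSet v, inferInstance, ?_, G.induce (G.neighborSet v), hasMinor_induce _,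
        by rwa [Nat.card_coe_set_eq], fun w => ?_⟩
      · exact ((Set.ncard_pos (Set.toFinite _)).1 (Nat.pos_of_ne_zero hv0)).to_subtype
      · rw [ncard_neighborSet_induce]
        exact hcodeg w w.2.symm

end DenseMinor

end SimpleGraph

/-! ### Robust connectivity -/

namespace SimpleGraph

section Robust

variable {V : Type*} {G : SimpleGraph V}

/-- Every vertex is adjacent to at least half of the number of vertices, and the graph stays
connected when any eighth of its vertices is deleted. -/
structure IsRobust (G : SimpleGraph V) : Prop where
  card_le : ∀ v, Nat.card V ≤ 2 * (G.neighborSet v).ncard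
  joinedIn : ∀ U : Set V, 8 * U.ncard ≤ Nat.card V → ∀ x ∉ U, ∀ y ∉ U, G.JoinedIn Uᶜ x y

/-- A graph in which every vertex is adjacent to at least half of the vertices contains a robust
subgraph on a positive proportion of its vertices: if some small set disconnects the graph, then
the smaller of two remaining components is so dense that any two of its vertices have many common
neighbours. -/
theorem exists_isRobust_minor {V : Type u} [Finite V] [Nonempty V] {G : SimpleGraph V}
    (h : ∀ v, Nat.card V ≤ 2 * (G.neighborSet v).ncard) :
    ∃ (W : Type u) (_ : Finite W) (_ : Nonempty W) (H : SimpleGraph W), G.HasMinor H ∧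
      3 * Nat.card V ≤ 8 * Nat.card W ∧ H.IsRobust := by
  by_cases hrob : ∀ U : Set V, 8 * U.ncard ≤ Nat.card V → ∀ x ∉ U, ∀ y ∉ U, G.JoinedIn Uᶜ x y
  · exact ⟨V, inferInstance, inferInstance, G,
      hasMinor_of_injective id Function.injective_id fun _ _ h => h, by omega, h, hrob⟩
  push Not at hrob
  obtain ⟨U, hU, x, hx, y, hy, hxy⟩ := hrob
  obtain ⟨z, hz, hzcard⟩ : ∃ z ∉ U, 2 * {w | G.JoinedIn Uᶜ z w}.ncard ≤ Nat.card V := by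
    by_contra! hcon
    have h1 := hcon x hx
    have h2 := hcon y hy
    have hd : Disjoint {w | G.JoinedIn Uᶜ x w} {w | G.JoinedIn Uᶜ y w} := by
      rw [Set.disjoint_left]
      exact fun w hw hw' => hxy (JoinedIn.trans hw (JoinedIn.symm hw'))
    have h3 := Set.ncard_le_ncard (Set.subset_univ
      ({w | G.JoinedIn Uᶜ x w} ∪ {w | G.JoinedIn Uᶜ y w})) (Set.toFinite _)
    rw [Set.ncard_union_eq hd, Set.ncard_univ] at h3
    omega
  let A : Set V := {w | G.JoinedIn Uᶜ z w}
  have hA0 : Nonempty A := ⟨z, .refl z⟩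
  have hApos : 0 < Nat.card A := Nat.card_pos
  have hAcard : Nat.card A = A.ncard := Nat.card_coe_set_eq A
  have hzcard' : 2 * A.ncard ≤ Nat.card V := hzcard
  have hdeg : ∀ a : A, 3 * Nat.card V ≤ 8 * ((G.induce A).neighborSet a).ncard := by
    intro a
    rw [ncard_neighborSet_induce]
    have hsub : G.neighborSet a ⊆ (G.neighborSet a ∩ A) ∪ U := by
      intro b hb
      by_cases hbU : b ∈ U
      · exact Or.inr hbU
      · exact Or.inl ⟨hb, JoinedIn.trans a.2 (.of_adj (JoinedIn.mem a.2 hz) hbU hb)⟩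
    have h1 := (Set.ncard_le_ncard hsub (Set.toFinite _)).trans (Set.ncard_union_le _ _)
    have h2 := h a
    omega
  have hdeg_le : ∀ a : A, ((G.induce A).neighborSet a).ncard ≤ A.ncard := fun a => by
    rw [← hAcard, ← Set.ncard_univ]
    exact Set.ncard_le_ncard (Set.subset_univ _) (Set.toFinite _)
  refine ⟨A, inferInstance, hA0, G.induce A, hasMinor_induce A, ?_, fun a => ?_, ?_⟩
  · have h1 := hdeg ⟨z, .refl z⟩
    have h2 := hdeg_le ⟨z, .refl z⟩
    omega
  · have h1 := hdeg a
    omega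
  · intro U' hU' p hp q hq
    have hn := Set.ncard_union_add_ncard_inter ((G.induce A).neighborSet p)
      ((G.induce A).neighborSet q)
    have hu : (((G.induce A).neighborSet p) ∪ ((G.induce A).neighborSet q)).ncard ≤ A.ncard := by
      rw [← hAcard, ← Set.ncard_univ]
      exact Set.ncard_le_ncard (Set.subset_univ _) (Set.toFinite _)
    have hp' := hdeg p
    have hq' := hdeg q
    obtain ⟨w, ⟨hpw, hqw⟩, hw⟩ : ∃ w ∈ (G.induce A).neighborSet p ∩ (G.induce A).neighborSet q,
        w ∉ U' := by
      by_contra! hcon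
      have := Set.ncard_le_ncard (show _ ⊆ U' from hcon) (Set.toFinite _)
      omega
    exact .trans (.of_adj hp hw hpw) (.of_adj hw hq hqw.symm)

/-- After deleting at most an eighth of a robust graph any two vertices have distance at most
five. Otherwise the vertices at positions `0`, `3` and `6` of a geodesic would have disjoint
neighbourhoods, each containing more than a third of the vertices. -/
theorem IsRobust.exists_small_connectedOn [Finite V] (hG : G.IsRobust) {U : Set V}
    (hU : 8 * U.ncard ≤ Nat.card V) {x y : V} (hx : x ∉ U) (hy : y ∉ U) :
    ∃ D : Set V, G.ConnectedOn D ∧ x ∈ D ∧ y ∈ D ∧ Disjoint D U ∧ D.ncard ≤ 6 := by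
  classical
  let H := G.induce Uᶜ
  have hcon : H.Connected :=
    induce_connected_iff_connectedOn.2 ⟨⟨x, hx⟩, fun a ha b hb => hG.joinedIn U hU a ha b hb⟩
  obtain ⟨p, hp⟩ := hcon.exists_walk_length_eq_dist ⟨x, hx⟩ ⟨y, hy⟩
  have hlen : p.length ≤ 5 := by
    by_contra! hlen
    have h1 : ∀ i, H.dist ⟨x, hx⟩ (p.getVert i) ≤ i := fun i =>
      (dist_le (p.take i)).trans (by rw [Walk.take_length]; exact min_le_left _ _)
    have h2 : ∀ i ≤ p.length, i ≤ H.dist ⟨x, hx⟩ (p.getVert i) := fun i hi => by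
      have h3 := hcon.dist_triangle (u := ⟨x, hx⟩) (v := p.getVert i) (w := ⟨y, hy⟩)
      have h4 : H.dist (p.getVert i) ⟨y, hy⟩ ≤ p.length - i :=
        (dist_le (p.drop i)).trans (by rw [Walk.drop_length])
      rw [← hp] at h3
      omega
    have hdis : ∀ a b : (Uᶜ : Set V), 3 ≤ H.dist a b →
        Disjoint (H.neighborSet a) (H.neighborSet b) := by
      intro a b hab
      rw [Set.disjoint_left]
      intro c hac hbc
      have h3 := hcon.dist_triangle (u := a) (v := c) (w := b)
      have h4 : H.dist a c = 1 := dist_eq_one_iff_adj.2 hac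
      have h5 : H.dist c b = 1 := dist_eq_one_iff_adj.2 hbc.symm
      omega
    have hd1 := hdis ⟨x, hx⟩ (p.getVert 3) (h2 3 (by omega))
    have hd2 := hdis ⟨x, hx⟩ (p.getVert 6) ((h2 6 (by omega)).trans' (by omega))
    have hd3 := hdis (p.getVert 3) (p.getVert 6) (by
      have h3 := hcon.dist_triangle (u := ⟨x, hx⟩) (v := p.getVert 3) (w := p.getVert 6)
      have h4 := h1 3
      have h5 := h2 6 (by omega)
      omega)
    have hdeg : ∀ a : (Uᶜ : Set V), 3 * Nat.card V ≤ 8 * (H.neighborSet a).ncard := by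
      intro a
      rw [show (H.neighborSet a).ncard = _ from ncard_neighborSet_induce a]
      have hsub : G.neighborSet a ⊆ (G.neighborSet a ∩ Uᶜ) ∪ U := by
        intro b hb
        by_cases hbU : b ∈ U
        · exact Or.inr hbU
        · exact Or.inl ⟨hb, hbU⟩
      have h1 := (Set.ncard_le_ncard hsub (Set.toFinite _)).trans (Set.ncard_union_le _ _)
      have h2 := hG.card_le a
      omega
    have h3 := Set.ncard_le_ncard (Set.subset_univ
      (H.neighborSet ⟨x, hx⟩ ∪ H.neighborSet (p.getVert 3) ∪ H.neighborSet (p.getVert 6)))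
      (Set.toFinite _)
    rw [Set.ncard_union_eq (hd2.union_left hd3), Set.ncard_union_eq hd1, Set.ncard_univ] at h3
    have h4 := hdeg ⟨x, hx⟩
    have h5 := hdeg (p.getVert 3)
    have h6 := hdeg (p.getVert 6)
    have h7 : Nat.card (Uᶜ : Set V) ≤ Nat.card V := Nat.card_le_card_of_injective _
      Subtype.val_injective
    have h8 : 0 < Nat.card V := Nat.card_pos_iff.2 ⟨⟨x⟩, inferInstance⟩
    omega
  refine ⟨Subtype.val '' {v | v ∈ p.support}, ConnectedOn.image_val
    (induce_connected_iff_connectedOn.1 p.connected_induce_support), ⟨_, p.start_mem_support, rfl⟩,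
    ⟨_, p.end_mem_support, rfl⟩, ?_, ?_⟩
  · rw [Set.disjoint_left]
    rintro _ ⟨a, -, rfl⟩
    exact a.2
  · refine (Set.ncard_image_le (Set.toFinite _)).trans ?_
    have : {v | v ∈ p.support} = (p.support.toFinset : Set (Uᶜ : Set V)) := by
      ext; simp
    rw [this, Set.ncard_coe_finset]
    refine (List.toFinset_card_le _).trans ?_
    rw [Walk.length_support]
    omega

/-- After deleting at most an eighth of a robust graph any `s` vertices lie in a connected set of
size at most `6 * s`. -/
theorem IsRobust.exists_connectedOn_range [Finite V] (hG : G.IsRobust) {U : Set V}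
    (hU : 8 * U.ncard ≤ Nat.card V) {s : ℕ} (hs : 0 < s) {f : Fin s → V} (hf : ∀ i, f i ∉ U) :
    ∃ D : Set V, G.ConnectedOn D ∧ Set.range f ⊆ D ∧ Disjoint D U ∧ D.ncard ≤ 6 * s := by
  choose D hD hD0 hDi hDU hDc using fun i : Fin s =>
    hG.exists_small_connectedOn hU (hf ⟨0, hs⟩) (hf i)
  refine ⟨⋃ i, D i, ?_, ?_, ?_, ?_⟩
  · refine .of_root (x := f ⟨0, hs⟩) (Set.mem_iUnion.2 ⟨⟨0, hs⟩, hD0 _⟩) fun y hy => ?_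
    obtain ⟨i, hi⟩ := Set.mem_iUnion.1 hy
    exact ((hD i).2 _ (hD0 i) y hi).mono (Set.subset_iUnion D i)
  · rintro _ ⟨i, rfl⟩
    exact Set.mem_iUnion.2 ⟨i, hDi i⟩
  · exact Set.disjoint_iUnion_left.2 hDU
  · have h1 : (⋃ i, D i).ncard ≤ ∑ i : Fin s, (D i).ncard := by
      have := Set.ncard_iUnion_le_of_fintype D
      simpa using this
    refine h1.trans ((Finset.sum_le_sum fun i _ => hDc i).trans ?_)
    simp [mul_comm]

end Robust

/-! ### Complete minors in robust graphs -/

section CompleteMinor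

variable {V : Type*} {G : SimpleGraph V}

/-- The vertices that have no neighbour in `D`. -/
def undominated (G : SimpleGraph V) (D : Set V) : Set V := {v | ∀ x ∈ D, ¬ G.Adj x v}

/-- Some sequence of `s` vertices outside a small set `U` leaves few vertices undominated and is
contained in none of the given `k` small sets `b i`. A random sequence works: after multiplication
by `n ^ s`, where `n` is the number of vertices, the summands in `hnum` bound the numbers of
sequences that fail the first and the second requirement, and the right hand side is a lower
bound for the number of sequences that avoid `U`. -/
theorem exists_dominating_sequence [Finite V] [Nonempty V]
    (hG : ∀ v, Nat.card V ≤ 2 * (G.neighborSet v).ncard) {U : Set V}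
    (hU : 8 * U.ncard ≤ Nat.card V) {s k : ℕ} {β : ℝ} (hβ : 0 < β)
    (hnum : (1 / 2) ^ s / β + k * β ^ s < (7 / 8 : ℝ) ^ s) (b : Fin k → Set V)
    (hb : ∀ i, ((b i).ncard : ℝ) ≤ β * Nat.card V) :
    ∃ f : Fin s → V, (∀ j, f j ∉ U) ∧
      ((G.undominated (Set.range f)).ncard : ℝ) ≤ β * Nat.card V ∧ ∀ i, ∃ j, f j ∉ b i := by
  classical
  have := Fintype.ofFinite V
  by_contra! hcon
  set n : ℝ := (Nat.card V : ℝ) with hn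
  have hn0 : 0 < n := by rw [hn]; exact_mod_cast Nat.card_pos
  have hcardS : ∀ (S : Set V) [Fintype S], (S.toFinset.card : ℝ) = S.ncard := fun S _ => by
    rw [Set.ncard_eq_toFinset_card']
  let F : Finset (Fin s → V) := Fintype.piFinset fun _ => Uᶜ.toFinset
  have hF : ∀ f, f ∈ F ↔ ∀ j, f j ∉ U := fun f => by simp [F]
  have hFcard : ((7 / 8) * n) ^ s ≤ (F.card : ℝ) := by
    have h1 : (F.card : ℝ) = (Uᶜ.toFinset.card : ℝ) ^ s := by
      simp only [F, Fintype.card_piFinset_const]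
      push_cast
      rfl
    rw [h1]
    refine pow_le_pow_left₀ (by positivity) ?_ s
    rw [hcardS]
    have h2 : (U.ncard : ℝ) + (Uᶜ.ncard : ℝ) = n := by
      rw [hn]
      exact_mod_cast Set.ncard_add_ncard_compl U
    have h3 : 8 * (U.ncard : ℝ) ≤ n := by rw [hn]; exact_mod_cast hU
    linarith
  have hpi : ∀ (T : Set V) [DecidablePred fun f : Fin s → V => ∀ j, f j ∈ T],
      ((F.filter fun f => ∀ j, f j ∈ T).card : ℝ) ≤ (T.ncard : ℝ) ^ s := by
    intro T _
    have h1 : F.filter (fun f => ∀ j, f j ∈ T) ⊆ Fintype.piFinset fun _ => T.toFinset := by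
      intro f hf
      simpa using (Finset.mem_filter.1 hf).2
    have h2 := Finset.card_le_card h1
    rw [Fintype.card_piFinset_const] at h2
    rw [← hcardS]
    exact_mod_cast h2
  let F₁ := F.filter fun f => β * n < ((G.undominated (Set.range f)).ncard : ℝ)
  have hF₁ : (F₁.card : ℝ) ≤ (n / 2) ^ s / β := by
    have h1 : (F₁.card : ℝ) * (β * n) ≤ ∑ f ∈ F, ((G.undominated (Set.range f)).ncard : ℝ) := by
      rw [← nsmul_eq_mul]
      refine (Finset.card_nsmul_le_sum F₁ _ _ fun f hf => (Finset.mem_filter.1 hf).2.le).trans ?_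
      exact Finset.sum_le_sum_of_subset_of_nonneg (Finset.filter_subset _ _)
        fun _ _ _ => Nat.cast_nonneg _
    -- count the pairs of a sequence and a vertex it does not dominate in two ways
    have h2 : ∑ f ∈ F, ((G.undominated (Set.range f)).ncard : ℝ) =
        ∑ v : V, ((F.filter fun f => ∀ j, f j ∈ (G.neighborSet v)ᶜ).card : ℝ) := by
      have h3 : ∀ f : Fin s → V, (G.undominated (Set.range f)).ncard =
          (Finset.univ.filter fun v => ∀ j, f j ∈ (G.neighborSet v)ᶜ).card := by
        intro f
        rw [← Set.ncard_coe_finset]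
        congr 1
        ext v
        simp [undominated, G.adj_comm v]
      have h4 := Finset.sum_card_bipartiteAbove_eq_sum_card_bipartiteBelow (s := F)
        (t := Finset.univ) fun (f : Fin s → V) v => ∀ j, f j ∈ (G.neighborSet v)ᶜ
      rw [← Nat.cast_sum, ← Nat.cast_sum, Finset.sum_congr rfl fun f _ => h3 f]
      exact congrArg Nat.cast h4
    have h3 : ∀ v, ((F.filter fun f => ∀ j, f j ∈ (G.neighborSet v)ᶜ).card : ℝ) ≤ (n / 2) ^ s := by
      intro v
      refine (hpi (G.neighborSet v)ᶜ).trans (pow_le_pow_left₀ (by positivity) ?_ s)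
      have h4 : ((G.neighborSet v).ncard : ℝ) + ((G.neighborSet v)ᶜ.ncard : ℝ) = n := by
        rw [hn]
        exact_mod_cast Set.ncard_add_ncard_compl (G.neighborSet v)
      have h5 : n ≤ 2 * ((G.neighborSet v).ncard : ℝ) := by rw [hn]; exact_mod_cast hG v
      linarith
    have h4 : (F₁.card : ℝ) * (β * n) ≤ n * (n / 2) ^ s := by
      refine h1.trans (h2.le.trans ((Finset.sum_le_sum fun v _ => h3 v).trans ?_))
      rw [Finset.sum_const, Finset.card_univ, ← Nat.card_eq_fintype_card, nsmul_eq_mul]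
    rw [le_div_iff₀ hβ]
    refine le_of_mul_le_mul_right ?_ hn0
    linarith
  have hcover : F ⊆ F₁ ∪ Finset.univ.biUnion fun i => F.filter fun f => ∀ j, f j ∈ b i := by
    intro f hf
    by_cases h : β * n < ((G.undominated (Set.range f)).ncard : ℝ)
    · exact Finset.mem_union_left _ (Finset.mem_filter.2 ⟨hf, h⟩)
    · obtain ⟨i, hi⟩ := hcon f ((hF f).1 hf) (not_lt.1 h)
      exact Finset.mem_union_right _
        (Finset.mem_biUnion.2 ⟨i, Finset.mem_univ i, Finset.mem_filter.2 ⟨hf, hi⟩⟩)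
  have hF₂ : ((Finset.univ.biUnion fun i => F.filter fun f => ∀ j, f j ∈ b i).card : ℝ) ≤
      k * (β * n) ^ s := by
    have h1 : ((Finset.univ.biUnion fun i => F.filter fun f => ∀ j, f j ∈ b i).card : ℝ) ≤
        ∑ i : Fin k, ((F.filter fun f => ∀ j, f j ∈ b i).card : ℝ) := by
      exact_mod_cast Finset.card_biUnion_le
    refine h1.trans ((Finset.sum_le_sum fun i _ => (hpi (b i)).trans
      (pow_le_pow_left₀ (Nat.cast_nonneg _) (hb i) s)).trans ?_)
    simp
  have htotal : (F.card : ℝ) ≤ (n / 2) ^ s / β + k * (β * n) ^ s := by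
    have h1 : (F.card : ℝ) ≤ (F₁.card : ℝ) +
        ((Finset.univ.biUnion fun i => F.filter fun f => ∀ j, f j ∈ b i).card : ℝ) := by
      exact_mod_cast (Finset.card_le_card hcover).trans (Finset.card_union_le _ _)
    linarith
  have hfinal : (n / 2) ^ s / β + k * (β * n) ^ s = n ^ s * ((1 / 2) ^ s / β + k * β ^ s) := by
    rw [mul_pow, div_pow, div_pow, one_pow]
    ring
  have hlt := mul_lt_mul_of_pos_left hnum (pow_pos hn0 s)
  rw [mul_pow] at hFcard
  linarith

/-- Greedy construction of a complete minor: each branch set consists of a dominating sequence that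
meets the neighbourhoods of all earlier branch sets, made connected by short paths. -/
theorem IsRobust.hasMinor_top [Finite V] [Nonempty V] (hG : G.IsRobust) {s m : ℕ} (hs : 0 < s)
    (hsm : 48 * s * m ≤ Nat.card V) {β : ℝ} (hβ : 0 < β)
    (hnum : (1 / 2) ^ s / β + m * β ^ s < (7 / 8 : ℝ) ^ s) :
    G.HasMinor (⊤ : SimpleGraph (Fin m)) := by
  have key : ∀ k ≤ m, ∃ B : Fin k → Set V, (∀ i, G.ConnectedOn (B i)) ∧
      (∀ i, (B i).ncard ≤ 6 * s) ∧ (∀ i j, i ≠ j → Disjoint (B i) (B j)) ∧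
      (∀ i j, i ≠ j → G.Linked (B i) (B j)) ∧
      ∀ i, ((G.undominated (B i)).ncard : ℝ) ≤ β * Nat.card V := by
    intro k
    induction k with
    | zero => exact fun _ => ⟨fun i => i.elim0, by simp⟩
    | succ k ih =>
      intro hk
      obtain ⟨B, hBc, hBs, hBd, hBl, hBu⟩ := ih (by omega)
      have hU : 8 * (⋃ i, B i).ncard ≤ Nat.card V := by
        have h1 : (⋃ i, B i).ncard ≤ ∑ i : Fin k, (B i).ncard := by
          simpa using Set.ncard_iUnion_le_of_fintype B
        have h2 : ∑ i : Fin k, (B i).ncard ≤ k * (6 * s) :=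
          (Finset.sum_le_sum fun i _ => hBs i).trans (by simp)
        have h3 : k * (6 * s) ≤ m * (6 * s) := Nat.mul_le_mul_right _ (by omega)
        have h4 : 48 * s * m = 8 * (m * (6 * s)) := by ring
        omega
      obtain ⟨f, hfU, hfu, hfb⟩ := exists_dominating_sequence hG.card_le hU hβ
        (lt_of_le_of_lt (by gcongr; omega) hnum) (fun i => G.undominated (B i)) hBu
      obtain ⟨D, hDc, hfD, hDU, hDs⟩ := hG.exists_connectedOn_range hU hs hfU
      have hDB : ∀ i, Disjoint D (B i) := fun i => hDU.mono_right (Set.subset_iUnion B i)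
      have hDl : ∀ i, G.Linked D (B i) := fun i => by
        obtain ⟨j, hj⟩ := hfb i
        simp only [undominated, Set.mem_ofPred_eq, not_forall, not_not] at hj
        obtain ⟨x, hx, hxj⟩ := hj
        exact ⟨f j, hfD ⟨j, rfl⟩, x, hx, hxj.symm⟩
      refine ⟨Fin.cons D B, ?_, ?_, ?_, ?_, ?_⟩
      · exact Fin.cases hDc hBc
      · exact Fin.cases hDs hBs
      · intro i j
        refine Fin.cases ?_ (fun i => ?_) i <;> refine Fin.cases ?_ (fun j => ?_) j
        · exact fun h => absurd rfl h
        · exact fun _ => hDB j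
        · exact fun _ => (hDB i).symm
        · exact fun h => hBd i j fun h' => h (h' ▸ rfl)
      · intro i j
        refine Fin.cases ?_ (fun i => ?_) i <;> refine Fin.cases ?_ (fun j => ?_) j
        · exact fun h => absurd rfl h
        · exact fun _ => hDl j
        · exact fun _ => (hDl i).symm
        · exact fun h => hBl i j fun h' => h (h' ▸ rfl)
      · refine Fin.cases ?_ hBu
        refine le_trans ?_ hfu
        have hsub : G.undominated D ⊆ G.undominated (Set.range f) :=
          fun v hv x hx => hv x (hfD hx)
        exact_mod_cast Set.ncard_le_ncard hsub (Set.toFinite _)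
  obtain ⟨B, hBc, -, hBd, hBl, -⟩ := key m le_rfl
  exact hasMinor_iff.2 ⟨B, hBc, hBd, fun i j hij => hBl i j hij⟩

end CompleteMinor

end SimpleGraph

/-! ### Kostochka constants exist -/

namespace SimpleGraph

/-- For sequences of length `2 * t` and `β = 2 * (4 / 9) ^ t` the hypothesis of
`IsRobust.hasMinor_top` holds: the first summand is at most half of the right hand side, and the
second one is smaller than that because `β ^ (2 * t)` decays like `(4 / 9) ^ t ^ 2`. -/
theorem probability_estimate {t m : ℕ} (ht : 3 ≤ t) (hm : 2 * m ≤ 2 ^ t ^ 2) :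
    (1 / 2 : ℝ) ^ (2 * t) / (2 * (4 / 9) ^ t) + m * (2 * (4 / 9) ^ t) ^ (2 * t) <
      (7 / 8 : ℝ) ^ (2 * t) := by
  have h1 : (1 / 2 : ℝ) ^ (2 * t) / (2 * (4 / 9) ^ t) = (9 / 16) ^ t / 2 := by
    rw [pow_mul, div_mul_eq_div_div_swap, ← div_pow]
    norm_num
  have h2 : (9 / 16 : ℝ) ^ t ≤ (7 / 8) ^ (2 * t) := by
    rw [pow_mul]
    exact pow_le_pow_left₀ (by norm_num) (by norm_num) t
  have h3 : (2 : ℝ) * (4 / 9) ^ t ≤ (7 / 8) * (2 / 3) ^ t := by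
    have h4 : (2 / 3 : ℝ) ^ t ≤ (2 / 3) ^ 3 :=
      pow_le_pow_of_le_one (by norm_num) (by norm_num) ht
    have h5 : (4 / 9 : ℝ) ^ t = (2 / 3) ^ t * (2 / 3) ^ t := by
      rw [← mul_pow]; norm_num
    have h6 : (0 : ℝ) < (2 / 3) ^ t := by positivity
    rw [h5]
    nlinarith
  have h4 : ((2 : ℝ) * (4 / 9) ^ t) ^ (2 * t) ≤ (7 / 8) ^ (2 * t) * (4 / 9) ^ t ^ 2 := by
    refine (pow_le_pow_left₀ (by positivity) h3 _).trans (le_of_eq ?_)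
    rw [mul_pow, ← pow_mul, show t * (2 * t) = 2 * t ^ 2 by ring, pow_mul (2 / 3 : ℝ)]
    norm_num
  have h5 : (m : ℝ) * (4 / 9) ^ t ^ 2 < 1 / 2 := by
    have h6 : (2 : ℝ) * m ≤ 2 ^ t ^ 2 := by exact_mod_cast hm
    have h7 : (2 : ℝ) ^ t ^ 2 * (4 / 9) ^ t ^ 2 < 1 := by
      rw [← mul_pow]
      exact pow_lt_one₀ (by norm_num) (by norm_num) (by positivity)
    have h8 : (0 : ℝ) < (4 / 9) ^ t ^ 2 := by positivity
    nlinarith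
  have h6 : (0 : ℝ) < (7 / 8) ^ (2 * t) := by positivity
  have h7 : (m : ℝ) * (2 * (4 / 9) ^ t) ^ (2 * t) ≤
      (7 / 8) ^ (2 * t) * (m * (4 / 9) ^ t ^ 2) := by
    calc (m : ℝ) * (2 * (4 / 9) ^ t) ^ (2 * t) ≤ m * ((7 / 8) ^ (2 * t) * (4 / 9) ^ t ^ 2) := by
          gcongr
      _ = _ := by ring
  have h8 := mul_lt_mul_of_pos_left h5 h6
  rw [h1]
  linarith

theorem hasMinor_top_of_dense {V : Type u} [Finite V] [Nonempty V] {G : SimpleGraph V}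
    {d t m : ℕ} (ht : 3 ≤ t) (hm : 2 * m ≤ 2 ^ t ^ 2) (hd : 1 ≤ d) (hdt : 256 * t * m ≤ d)
    (h : d * Nat.card V ≤ G.edgeSet.ncard) : G.HasMinor (⊤ : SimpleGraph (Fin m)) := by
  obtain ⟨W, _, ⟨w⟩, H, hH, hW, hdeg⟩ := exists_minor_minDegree hd h
  have : Nonempty W := ⟨w⟩
  have hdW : d ≤ Nat.card W := (hdeg w).trans (by
    rw [← Set.ncard_univ]
    exact Set.ncard_le_ncard (Set.subset_univ _) (Set.toFinite _))
  obtain ⟨X, _, _, K, hK, hX, hrob⟩ := exists_isRobust_minor (G := H) fun v => by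
    have := hdeg v
    omega
  refine (hH.trans hK).trans (hrob.hasMinor_top (s := 2 * t) (by omega) ?_
    (β := 2 * (4 / 9) ^ t) (by positivity) (probability_estimate ht hm))
  have : 48 * (2 * t) * m = 96 * (t * m) := by ring
  have : 256 * t * m = 256 * (t * m) := by ring
  omega

theorem averageDegree_eq {V : Type u} [Fintype V] (G : SimpleGraph V) [DecidableRel G.Adj] :
    G.averageDegree = 2 * (G.edgeSet.ncard : ℝ) / (Nat.card V : ℝ) := by
  have h1 : G.edgeFinset.card = G.edgeSet.ncard := by
    rw [← coe_edgeFinset, Set.ncard_coe_finset]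
  rw [averageDegree, ← h1, Nat.card_eq_fintype_card]
  congr 1
  exact_mod_cast G.sum_degrees_eq_twice_card_edges

/-- The theorem of Kostochka and Thomason: an average degree of order `h * √(log h)` forces a
`K_{h+1}` minor. The sequences in `hasMinor_top_of_dense` have length `2 * t` with `t` of order
`√(log h)`, so that `2 ^ t ^ 2` exceeds a multiple of `h`. For `h = 1` the bound is zero, and the
graph has no edges. -/
theorem exists_isKostochkaConstant : ∃ a : ℝ, IsKostochkaConstant a := by
  refine ⟨10240, by norm_num, fun h hh V _ G _ hG => ?_⟩
  rcases isEmpty_or_nonempty V with hV | hV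
  · rw [averageDegree]
    simp only [Finset.univ_eq_empty, Finset.sum_empty, zero_div]
    positivity
  rcases hh.eq_or_lt with rfl | hh2
  · -- without a `K_2` minor there are no edges
    have : G.edgeSet = ∅ := by
      by_contra hne
      obtain ⟨e, he⟩ := Set.nonempty_iff_ne_empty.2 hne
      induction e with
      | _ x y =>
        have hxy : G.Adj x y := he
        refine hG (hasMinor_of_injective ![x, y] ?_ ?_)
        · intro i j
          fin_cases i <;> fin_cases j <;> simp [hxy.ne, hxy.ne']
        · intro i j
          fin_cases i <;> fin_cases j <;> simp [hxy, hxy.symm]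
    rw [averageDegree_eq, this]
    simp
  by_contra! hcon
  set L := Real.sqrt (Real.log (h : ℝ)) with hL
  have hh2' : (2 : ℝ) ≤ h := by exact_mod_cast hh2
  have hlog2 : (1 / 2 : ℝ) < Real.log 2 := by
    have := Real.log_two_gt_d9
    linarith
  have hlog : (1 / 2 : ℝ) < Real.log h :=
    hlog2.trans_le (Real.log_le_log (by norm_num) hh2')
  have hLsq : L ^ 2 = Real.log h := Real.sq_sqrt (by linarith)
  have hL0 : 0 ≤ L := Real.sqrt_nonneg _
  have hLhalf : 1 / 2 ≤ L := by nlinarith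
  obtain ⟨t, ht⟩ : ∃ t : ℕ, t = ⌈2 * L⌉₊ + 3 := ⟨_, rfl⟩
  have ht1 : 2 * L + 3 ≤ t := by
    have := Nat.le_ceil (2 * L)
    rw [ht]; push_cast; linarith
  have ht2 : (t : ℝ) ≤ 10 * L := by
    have := (Nat.ceil_lt_add_one (show 0 ≤ 2 * L by linarith)).le
    rw [ht]; push_cast; linarith
  have hm : 2 * (h + 1) ≤ 2 ^ t ^ 2 := by
    have h1 : (h : ℝ) ≤ 2 ^ (2 * Real.log h) := by
      rw [Real.rpow_def_of_pos (by norm_num)]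
      calc (h : ℝ) = Real.exp (Real.log h) := (Real.exp_log (by linarith)).symm
        _ ≤ _ := Real.exp_le_exp.2 (by nlinarith)
    have h2 : (2 : ℝ) ^ (2 * Real.log h + 2) ≤ 2 ^ ((t ^ 2 : ℕ) : ℝ) := by
      refine Real.rpow_le_rpow_of_exponent_le (by norm_num) ?_
      push_cast
      nlinarith
    rw [Real.rpow_natCast, Real.rpow_add (by norm_num)] at h2
    have h3 : (2 : ℝ) * (h + 1) ≤ 2 ^ t ^ 2 := by
      refine le_trans ?_ h2
      norm_num
      linarith
    exact_mod_cast h3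
  have hn0 : (0 : ℝ) < Nat.card V := by exact_mod_cast Nat.card_pos
  have hLh : 1 ≤ (h : ℝ) * L := by nlinarith
  have htm : ((256 * t * (h + 1) : ℕ) : ℝ) ≤ 5120 * (h * L) := by
    push_cast
    have h1 : (t : ℝ) * (h + 1) ≤ 10 * L * (2 * h) := by
      gcongr
      linarith
    linarith
  refine hG (hasMinor_top_of_dense (d := 256 * t * (h + 1)) (by omega) hm ?_ le_rfl ?_)
  · have : 0 < t := by omega
    exact Nat.succ_le_of_lt (by positivity)
  · rw [averageDegree_eq, lt_div_iff₀ hn0] at hcon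
    have h1 : ((256 * t * (h + 1) : ℕ) : ℝ) * Nat.card V ≤ 5120 * (h * L) * Nat.card V := by
      gcongr
    have h2 : ((256 * t * (h + 1) : ℕ) : ℝ) * Nat.card V ≤ G.edgeSet.ncard := by nlinarith
    exact_mod_cast h2

theorem CompleteMinorFree.minorDegreeLE {a : ℝ} (ha : IsKostochkaConstant a) {h : ℕ} (hh : 1 ≤ h)
    {V : Type u} {G : SimpleGraph V} (hG : G.CompleteMinorFree (h + 1)) :
    G.MinorDegreeLE (kostochkaBound a h) := by
  classical
  intro n hn H hH
  by_contra! hcon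
  have h1 := ha.2 h hh (Fin n) H fun h => hG (hH.trans h)
  have h2 := h1.trans (Nat.le_ceil _)
  have hn0 : (0 : ℝ) < Fintype.card (Fin n) := by simpa using hn
  rw [averageDegree, div_le_iff₀ hn0] at h2
  have : Nonempty (Fin n) := ⟨⟨0, hn⟩⟩
  have h3 : ∑ _v : Fin n, kostochkaBound a h < ∑ v : Fin n, H.degree v :=
    Finset.sum_lt_sum_of_nonempty Finset.univ_nonempty fun v _ => by
      have h4 : H.degree v = (H.neighborSet v).ncard := by
        rw [← card_neighborSet_eq_degree, ← Nat.card_eq_fintype_card]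
        rfl
      rw [h4]
      exact hcon v
  rw [Finset.sum_const, Finset.card_univ, smul_eq_mul, mul_comm] at h3
  have h5 : ((kostochkaBound a h * Fintype.card (Fin n) : ℕ) : ℝ) <
      ((∑ v : Fin n, H.degree v : ℕ) : ℝ) := by exact_mod_cast h3
  push_cast at h5
  rw [kostochkaBound] at h5
  linarith

end SimpleGraph

theorem mainTheorem5 :
    (∃ a : ℝ, IsKostochkaConstant a) ∧
    ∀ a : ℝ, IsKostochkaConstant a →
      ∀ h : ℕ, 1 ≤ h →
        ∀ (V : Type u) [Finite V] (G : SimpleGraph V),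
          G.CompleteMinorFree (h + 1) →
          (∀ p : ℕ, p.Prime → p ∣ Nat.card (G ≃g G) → max (kostochkaBound a h) 2 < p) →
          IsAbelianProductWreath (G ≃g G) := by
  refine ⟨SimpleGraph.exists_isKostochkaConstant, fun a ha h hh V _ G hG hp => ?_⟩
  let e := G.autMulEquivColorAut PUnit.unit.{u + 1}
  refine .of_mulEquiv _ _ e.symm ((hG.minorDegreeLE ha hh).isAbelianProductWreath_colorAut ?_)
  exact PrimeDivisorsGT.of_dvd hp (Nat.card_congr e.toEquiv).symm.dvd
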